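/- **Functional equations.** Let $q\ge 1$ be an integer and let $X=(VX,EX)$ be a countable $(q+1)$-regular simple graph (not necessarily connected). Let $\Gamma$ be a group of automorphisms of $X$ acting freely (no $\gamma\neq 1$ in $\Gamma$ fixes a vertex) and with finitely many orbits on $VX$; put $B=X/\Gamma$, let $|VB|$ be the number of $\Gamma$-orbits of vertices, and let $\chi(B)=|VB|-|EB|$, where $|EB|$ is half the number of $\Gamma$-orbits of oriented edges. A reduced closed path is a closed path of length $\geq 1$ without backtracking and without tail; it is primitive if it is not obtained by going $n\ge 2$ times around a closed path. A prime cycle is a primitive reduced closed path up to the choice of its origin; $|C|$ is its length, $\Gamma_C=\{\gamma\in\Gamma:\gamma C=C\}$ its stabilizer, and $[\mathcal P]_\Gamma$ is the set of $\Gamma$-orbits of prime cycles. Let $A$ be the adjacency operator on $\ell^2(VX)$ and $\Delta(u)=(1+qu^2)I-uA$. For a bounded operator $T$ on $\ell^2(VX)$ commuting with $\Gamma$ let $\mathrm{Tr}_\Gamma(T)=\sum_{x\in F}T(x,x)$, where $F$ is a set of representatives of $VX/\Gamma$; if $0\notin\mathrm{conv}\,\sigma(T)$, let $$\mathrm{det}_\Gamma(T)=\exp\mathrm{Tr}_\Gamma\Bigl(\frac1{2\pi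 i}\int_{\partial D}\log\lambda\,(\lambda-T)^{-1}d\lambda\Bigr),$$ where $D$ is an open disc containing $\mathrm{conv}\,\sigma(T)$ whose closure omits $0$, and $\log$ is a branch of the logarithm on a neighbourhood of $\overline D$ (the result does not depend on these choices). Let $$\Omega=\mathbb C\setminus\Bigl(\{|u|^2=\tfrac1q\}\cup\{x\in\mathbb R:\tfrac1q\le|x|\le1\}\Bigr).$$ Then $0\notin\mathrm{conv}\,\sigma(\Delta(u))$ for every $u\in\Omega$, and the function $$Z_{X,\Gamma}(u)=(1-u^2)^{\chi(B)}\,\mathrm{det}_\Gamma(\Delta(u))^{-1},\qquad u\in\Omega,$$ extends the Ihara zeta function: for $|u|<\frac1q$ the Euler product below converges unconditionally and $$Z_{X,\Gamma}(u)=\prod_{[C]\in[\mathcal P]_\Gamma}(1-u^{|C|})^{-1/|\Gamma_C|}.$$ Moreover, for all $u\in\Omega$ with $u\neq0$ one has $\frac1{qu}\in\Omega$, and (i) $\Lambda(u):=(1-u^2)^{-\chi(B)}(1-u^2)^{|VB|/2}(1-q^2u^2)^{|VB|/2}Z_{X,\Gamma}(u)$ satisfies $\Lambda(u)=(-1)^{|VB|}\,\Lambda\bigl(\tfrac1{qu}\bigr)$;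 (ii) $\xi(u):=(1-u^2)^{-\chi(B)}(1-u)^{|VB|}(1-qu)^{|VB|}Z_{X,\Gamma}(u)$ satisfies $\xi(u)=\xi\bigl(\tfrac1{qu}\bigr)$; (iii) $\Xi(u):=(1-u^2)^{-\chi(B)}(1+qu^2)^{|VB|}Z_{X,\Gamma}(u)$ satisfies $\Xi(u)=\Xi\bigl(\tfrac1{qu}\bigr)$. Non-integral powers are principal powers. -/

import Mathlib

noncomputable section

namespace IharaPeriodic

/-! ### Closed paths and cycles -/

/-- A closed path `(v₀, …, v_m = v₀)` of length `m ≥ 1` in a simple graph. The vertices are indexed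
by `ℕ`, periodically with period `m`, so that indices are read modulo `m`. -/
@[ext]
structure ClosedPath {V : Type*} (G : SimpleGraph V) where
  len : ℕ
  vert : ℕ → V
  len_pos : 0 < len
  periodic : ∀ i, vert (i + len) = vert i
  adj : ∀ i, G.Adj (vert i) (vert (i + 1))

namespace ClosedPath

variable {V : Type*} {G : SimpleGraph V}

/-- No backtracking: `v_{i-1} ≠ v_{i+1}` for `1 ≤ i ≤ m - 1`. -/
def IsProper (C : ClosedPath G) : Prop :=
  ∀ i, 1 ≤ i → i + 1 ≤ C.len → C.vert (i - 1) ≠ C.vert (i + 1)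

/-- There is `1 ≤ k ≤ [m/2] - 1` with `v_j = v_{m-j}` for `j = 1, …, k`. -/
def HasTail (C : ClosedPath G) : Prop :=
  ∃ k, 1 ≤ k ∧ k + 1 ≤ C.len / 2 ∧ ∀ j, 1 ≤ j → j ≤ k → C.vert j = C.vert (C.len - j)

/-- Reduced closed paths: no backtracking and no tail. -/
def IsReduced (C : ClosedPath G) : Prop := C.IsProper ∧ ¬ C.HasTail

/-- Primitive: not obtained by going `n ≥ 2` times around some closed path. -/
def IsPrimitive (C : ClosedPath G) : Prop :=
  ¬ ∃ (D : ClosedPath G) (n : ℕ), 2 ≤ n ∧ C.len = n * D.len ∧ ∀ j, C.vert j = D.vert j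

theorem vert_add_mul (C : ClosedPath G) (i n : ℕ) : C.vert (i + n * C.len) = C.vert i := by
  induction n with
  | zero => simp
  | succ n ih => rw [Nat.succ_mul, ← add_assoc, C.periodic, ih]

/-- Two closed paths are equivalent if they differ by a shift of the origin. -/
instance rotation (G : SimpleGraph V) : Setoid (ClosedPath G) where
  r C D := C.len = D.len ∧ ∃ k, ∀ j, D.vert j = C.vert (j + k)
  iseqv := by
    refine ⟨fun C => ⟨rfl, 0, fun j => rfl⟩, ?_, ?_⟩
    · rintro C D ⟨h, k, hk⟩
      refine ⟨h.symm, k * C.len - k, fun j => ?_⟩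
      have : k ≤ k * C.len := Nat.le_mul_of_pos_right k C.len_pos
      rw [hk, add_assoc, Nat.sub_add_cancel this, vert_add_mul]
    · rintro C D E ⟨h, k, hk⟩ ⟨h', k', hk'⟩
      exact ⟨h.trans h', k' + k, fun j => by rw [hk', hk, add_assoc]⟩

/-- Automorphisms of the graph act on closed paths vertex by vertex. -/
instance : MulAction (G ≃g G) (ClosedPath G) where
  smul γ C :=
    { len := C.len
      vert := fun i => γ (C.vert i)
      len_pos := C.len_pos
      periodic := fun i => by rw [C.periodic]
      adj := fun i => γ.map_adj_iff.2 (C.adj i) }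
  one_smul _ := rfl
  mul_smul _ _ _ := rfl

end ClosedPath

/-- A cycle: a closed path up to the choice of its origin. -/
def PathCycle {V : Type*} (G : SimpleGraph V) : Type _ := Quotient (ClosedPath.rotation G)

namespace PathCycle

variable {V : Type*} {G : SimpleGraph V}

/-- The length `|C|` of a cycle. -/
def len : PathCycle G → ℕ := Quotient.lift ClosedPath.len fun _ _ h => h.1

instance : MulAction (G ≃g G) (PathCycle G) where
  smul γ := Quotient.map (fun C => γ • C) fun _ _ ⟨h, k, hk⟩ =>
    ⟨h, k, fun j => congrArg γ (hk j)⟩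
  one_smul := by rintro ⟨C⟩; rfl
  mul_smul := by rintro γ γ' ⟨C⟩; rfl

/-- Prime cycles: the classes of primitive reduced closed paths. -/
def IsPrime (c : PathCycle G) : Prop :=
  ∃ C : ClosedPath G, C.IsReduced ∧ C.IsPrimitive ∧ (Quotient.mk _ C : PathCycle G) = c

end PathCycle

section zeta

variable {V : Type*} (G : SimpleGraph V) (Γ : Subgroup (G ≃g G))

/-- The set `[𝒫]_Γ` of `Γ`-equivalence classes of prime cycles. -/
def PrimeClass : Type _ :=
  Quotient ((MulAction.orbitRel Γ (PathCycle G)).comap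
    (Subtype.val : {c : PathCycle G // c.IsPrime} → PathCycle G))

/-- The factor `(1 - u^|C|)^(-1/|Γ_C|)` of the Euler product; it is computed on a representative
`C`, on which it does not depend. -/
def eulerFactor (u : ℂ) (P : PrimeClass G Γ) : ℂ :=
  (1 - u ^ (Quotient.out P).1.len) ^
    (-(1 / (Nat.card (MulAction.stabilizer Γ (Quotient.out P).1) : ℂ)))

/-- `|VB|`, the number of vertices of the quotient `B = X/Γ`. -/
def cardVB : ℕ := Nat.card (MulAction.orbitRel.Quotient Γ V)

/-- The number of oriented edges of the quotient `B = X/Γ`: the number of `Γ`-orbits of pairs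
`(v, w)` of adjacent vertices. -/
def cardOrientedEB : ℕ :=
  Nat.card (Quotient ((MulAction.orbitRel Γ (V × V)).comap
    (Subtype.val : {p : V × V // G.Adj p.1 p.2} → V × V)))

/-- The Euler characteristic `χ(B) = |VB| - |EB|`, where the number `|EB|` of (geometric) edges is
half the number of oriented edges. -/
def eulerChar : ℚ := cardVB G Γ - cardOrientedEB G Γ / 2

end zeta

/-! ### The adjacency operator, the trace and the determinant -/

/-- The Hilbert space `ℓ²(V)`. -/
abbrev L2 (V : Type*) : Type _ := lp (fun _ : V => ℂ) 2

section adjacency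

variable {V : Type*} (G : SimpleGraph V) [G.LocallyFinite]

theorem sum_adj_sq_le {d : ℕ} (hd : ∀ v, G.degree v ≤ d) (f : L2 V) (s : Finset V) :
    ∑ x ∈ s, ‖∑ y ∈ G.neighborFinset x, f y‖ ^ (2 : ENNReal).toReal
      ≤ (d * ‖f‖) ^ (2 : ENNReal).toReal := by
  classical
  simp only [ENNReal.toReal_ofNat, Real.rpow_ofNat]
  have h1 : ∀ x, ‖∑ y ∈ G.neighborFinset x, f y‖ ^ 2
      ≤ d * ∑ y ∈ G.neighborFinset x, ‖f y‖ ^ 2 := fun x => by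
    calc ‖∑ y ∈ G.neighborFinset x, f y‖ ^ 2
        ≤ (∑ y ∈ G.neighborFinset x, ‖f y‖) ^ 2 := by
          gcongr
          exact norm_sum_le _ _
      _ ≤ (G.neighborFinset x).card * ∑ y ∈ G.neighborFinset x, ‖f y‖ ^ 2 :=
          sq_sum_le_card_mul_sum_sq
      _ ≤ d * ∑ y ∈ G.neighborFinset x, ‖f y‖ ^ 2 := by
          gcongr
          exact hd x
  set t : Finset V := s.biUnion fun x => G.neighborFinset x with ht
  have h2 : ∑ x ∈ s, ∑ y ∈ G.neighborFinset x, ‖f y‖ ^ 2 ≤ ∑ y ∈ t, d * ‖f y‖ ^ 2 := by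
    rw [Finset.sum_comm' (t' := t) (s' := fun y => s.filter fun x => G.Adj x y)
      (by
        intro x y
        simp only [ht, SimpleGraph.mem_neighborFinset, Finset.mem_filter, Finset.mem_biUnion]
        exact ⟨fun h => ⟨⟨h.1, h.2⟩, x, h.1, h.2⟩, fun h => h.1⟩)]
    refine Finset.sum_le_sum fun y _ => ?_
    rw [Finset.sum_const, nsmul_eq_mul]
    gcongr
    refine (Finset.card_le_card fun x hx => ?_).trans (hd y)
    rw [SimpleGraph.mem_neighborFinset]
    exact (Finset.mem_filter.1 hx).2.symm
  have h3 : ∑ y ∈ t, ‖f y‖ ^ 2 ≤ ‖f‖ ^ 2 := by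
    have := lp.sum_rpow_le_norm_rpow (p := 2) (by simp) f t
    simpa using this
  calc ∑ x ∈ s, ‖∑ y ∈ G.neighborFinset x, f y‖ ^ 2
      ≤ ∑ x ∈ s, d * ∑ y ∈ G.neighborFinset x, ‖f y‖ ^ 2 := Finset.sum_le_sum fun x _ => h1 x
    _ = d * ∑ x ∈ s, ∑ y ∈ G.neighborFinset x, ‖f y‖ ^ 2 := by rw [Finset.mul_sum]
    _ ≤ d * ∑ y ∈ t, d * ‖f y‖ ^ 2 := by gcongr
    _ = d * (d * ∑ y ∈ t, ‖f y‖ ^ 2) := by rw [← Finset.mul_sum]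
    _ ≤ d * (d * ‖f‖ ^ 2) := by gcongr
    _ = (d * ‖f‖) ^ 2 := by ring

/-- The adjacency operator `(A f)(x) = ∑_{y ∼ x} f(y)` on `ℓ²(V)`, for a graph with degrees
bounded by `d`. -/
def adjOp {d : ℕ} (hd : ∀ v, G.degree v ≤ d) : L2 V →L[ℂ] L2 V :=
  LinearMap.mkContinuous
    { toFun := fun f => ⟨fun x => ∑ y ∈ G.neighborFinset x, f y,
        memℓp_gen' (sum_adj_sq_le G hd f)⟩
      map_add' := fun f g => by
        ext x
        exact Finset.sum_add_distrib
      map_smul' := fun c f => by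
        ext x
        simp [Finset.mul_sum] }
    d fun f => lp.norm_le_of_forall_sum_le (by simp) (by positivity) (sum_adj_sq_le G hd f)

end adjacency

open Classical in
/-- The trace `Tr_Γ(T) = ∑_{x ∈ F} T(x, x)`, where `F` is a set of representatives of the
`Γ`-orbits in `V` and `T(x, x)` is the matrix coefficient `⟨δ_x, T δ_x⟩`; on operators commuting
with the action of `Γ` it does not depend on the choice of `F`. -/
def traceΓ {V : Type*} (G : SimpleGraph V) (Γ : Subgroup (G ≃g G)) (T : L2 V →L[ℂ] L2 V) : ℂ :=
  ∑ᶠ o : MulAction.orbitRel.Quotient Γ V, (T (lp.single 2 (Quotient.out o) 1)) (Quotient.out o)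

/-- A compact convex set of complex numbers that omits `0` lies in an open disc whose closure
omits `0`. -/
theorem exists_disc {K : Set ℂ} (hK : IsCompact K) (hc : Convex ℝ K) (h0 : (0 : ℂ) ∉ K) :
    ∃ D : ℂ × ℝ, K ⊆ Metric.ball D.1 D.2 ∧ 0 < D.2 ∧ D.2 < ‖D.1‖ := by
  rcases K.eq_empty_or_nonempty with rfl | hne
  · exact ⟨(1, 1 / 2), by simp, by norm_num, by norm_num⟩
  obtain ⟨p, hp, hmin⟩ := exists_norm_eq_iInf_of_complete_convex hne hK.isComplete hc 0
  have hin := (norm_eq_iInf_iff_real_inner_le_zero hc hp).1 hmin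
  have hp0 : 0 < ‖p‖ := norm_pos_iff.2 fun h => h0 (h ▸ hp)
  obtain ⟨M, hM⟩ := hK.isBounded.exists_norm_le
  have hM0 : 0 ≤ M := (norm_nonneg p).trans (hM p hp)
  set t : ℝ := (M ^ 2 + 1) / ‖p‖ ^ 2 with ht
  have ht0 : 0 < t := by positivity
  have htp : t * ‖p‖ ^ 2 = M ^ 2 + 1 := by rw [ht]; field_simp
  have key : ∀ z ∈ K, dist z (t • p) < ‖t • p‖ := fun z hz => by
    have h1 : ‖p‖ ^ 2 ≤ inner ℝ z p := by
      have := hin z hz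
      rw [zero_sub, inner_neg_left, inner_sub_right, real_inner_self_eq_norm_sq,
        real_inner_comm] at this
      linarith
    have h2 : dist z (t • p) ^ 2 < ‖t • p‖ ^ 2 := by
      rw [dist_eq_norm, norm_sub_sq_real, real_inner_smul_right]
      have h3 : ‖z‖ ^ 2 ≤ M ^ 2 := by
        gcongr
        exact hM z hz
      have h4 : t * ‖p‖ ^ 2 ≤ t * inner ℝ z p := by gcongr
      nlinarith [sq_nonneg M]
    exact lt_of_pow_lt_pow_left₀ 2 (norm_nonneg _) h2
  obtain ⟨z₀, hz₀, hmax⟩ := hK.exists_isMaxOn hne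
    (Continuous.continuousOn (f := fun z => dist z (t • p)) (by fun_prop))
  obtain ⟨r, hr1, hr2⟩ := exists_between (key z₀ hz₀)
  exact ⟨(t • p, r), fun z hz => lt_of_le_of_lt (hmax hz) hr1, dist_nonneg.trans_lt hr1, hr2⟩

theorem isCompact_convexHull {s : Set ℂ} (hs : IsCompact s) : IsCompact (convexHull ℝ s) := by
  have heq : convexHull ℝ s = ⋃ n ∈ Finset.range 4,
      (fun p : (Fin n → ℝ) × (Fin n → ℂ) => ∑ i, p.1 i • p.2 i) ''
        (stdSimplex ℝ (Fin n) ×ˢ Set.univ.pi fun _ => s) := by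
    ext x
    simp only [Set.mem_iUnion, Set.mem_image, Set.mem_prod, Set.mem_univ_pi, Prod.exists,
      exists_prop]
    constructor
    · intro hx
      obtain ⟨ι, _, z, w, hz, hind, hw, hw1, rfl⟩ := eq_pos_convex_span_of_mem_convexHull hx
      have hcard : Fintype.card ι ≤ 3 := by
        have h1 := hind.card_le_finrank_succ
        have h2 := Submodule.finrank_le (vectorSpan ℝ (Set.range z))
        rw [Complex.finrank_real_complex] at h2
        omega
      let e := (Fintype.equivFin ι).symm
      refine ⟨Fintype.card ι, Finset.mem_range.2 (by omega), fun i => w (e i), fun i => z (e i),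
        ⟨⟨fun i => (hw _).le, ?_⟩, fun i => hz ⟨_, rfl⟩⟩, ?_⟩
      · rw [← hw1]
        exact e.sum_comp w
      · exact e.sum_comp fun i => w i • z i
    · rintro ⟨n, -, w, z, ⟨⟨hw, hw1⟩, hz⟩, rfl⟩
      exact (convex_convexHull ℝ s).sum_mem (fun i _ => hw i) hw1
        fun i _ => subset_convexHull ℝ s (hz i)
  rw [heq]
  refine (Finset.range 4).isCompact_biUnion fun n _ => ?_
  refine ((isCompact_stdSimplex ℝ (Fin n)).prod (isCompact_univ_pi fun _ => hs)).image ?_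
  fun_prop

section determinant

variable {V : Type*}

/-- The domain of the analytic determinant: `0` is not in the convex hull of the spectrum. -/
def InDetDomain (T : L2 V →L[ℂ] L2 V) : Prop := (0 : ℂ) ∉ convexHull ℝ (spectrum ℂ T)

theorem InDetDomain.exists_disc {T : L2 V →L[ℂ] L2 V} (h : InDetDomain T) :
    ∃ D : ℂ × ℝ, convexHull ℝ (spectrum ℂ T) ⊆ Metric.ball D.1 D.2 ∧ 0 < D.2 ∧ D.2 < ‖D.1‖ :=
  IharaPeriodic.exists_disc (isCompact_convexHull (spectrum.isCompact T)) (convex_convexHull ℝ _) h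

/-- `(1/2πi) ∮ log λ (λ - T)⁻¹ dλ` over the circle of centre `c` and radius `r < |c|`, where
`log λ := Log c + Log (λ/c)` is a branch of the logarithm on the disc `|λ - c| < |c|`. -/
def logOnDisc (T : L2 V →L[ℂ] L2 V) (c : ℂ) (r : ℝ) : L2 V →L[ℂ] L2 V :=
  (2 * Real.pi * Complex.I : ℂ)⁻¹ •
    ∮ z in C(c, r), (Complex.log c + Complex.log (z / c)) • resolvent T z

open Classical in
/-- The analytic determinant `det_Γ(T) = exp (Tr_Γ (log T))`, where `log T` is given by the
holomorphic functional calculus on a simply connected region containing the convex hull of the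
spectrum of `T`. The region is taken to be a disc whose closure omits `0`; one exists whenever `0` is
not in that convex hull, and the value does not depend on it. -/
def detΓ (G : SimpleGraph V) (Γ : Subgroup (G ≃g G)) (T : L2 V →L[ℂ] L2 V) : ℂ :=
  if h : InDetDomain T then
    Complex.exp (traceΓ G Γ (logOnDisc T h.exists_disc.choose.1 h.exists_disc.choose.2))
  else 0

end determinant

/-! ### The zeta function of a regular periodic graph and its completions -/

/-- The plane without the circle `|u|² = 1/q` and the real points with `1/q ≤ |u| ≤ 1`. -/
def Omega (q : ℕ) : Set ℂ :=
  {u | u.re ^ 2 + u.im ^ 2 ≠ 1 / q ∧ ¬ (u.im = 0 ∧ 1 / (q : ℝ) ≤ |u.re| ∧ |u.re| ≤ 1)}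

section completed

variable {V : Type*} (G : SimpleGraph V) [G.LocallyFinite] {q : ℕ}
  (hreg : G.IsRegularOfDegree (q + 1)) (Γ : Subgroup (G ≃g G)) (u : ℂ)

/-- `Δ(u) = (1 + q u²) I - u A`. -/
def deltaOp : L2 V →L[ℂ] L2 V :=
  (1 + q * u ^ 2) • (1 : L2 V →L[ℂ] L2 V) - u • adjOp G (fun v => (hreg v).le)

/-- The zeta function `Z_{X,Γ}`, extended to `Ω` by the determinant formula. -/
def zeta : ℂ := (1 - u ^ 2) ^ (eulerChar G Γ : ℂ) * (detΓ G Γ (deltaOp G hreg u))⁻¹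

def completedΛ : ℂ :=
  (1 - u ^ 2) ^ (-(eulerChar G Γ : ℂ)) * (1 - u ^ 2) ^ ((cardVB G Γ : ℂ) / 2) *
    (1 - q ^ 2 * u ^ 2) ^ ((cardVB G Γ : ℂ) / 2) * zeta G hreg Γ u

def completedξ : ℂ :=
  (1 - u ^ 2) ^ (-(eulerChar G Γ : ℂ)) * (1 - u) ^ cardVB G Γ * (1 - q * u) ^ cardVB G Γ *
    zeta G hreg Γ u

def completedΞ : ℂ :=
  (1 - u ^ 2) ^ (-(eulerChar G Γ : ℂ)) * (1 + q * u ^ 2) ^ cardVB G Γ * zeta G hreg Γ u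

end completed

end IharaPeriodic

end

/-! The adjacency operator A is self-adjoint with spectrum in [-(q+1), q+1], and Δ(u) is an affine
function of A. Hence det_Γ Δ(u) = exp Tr_Γ g(A) for any continuous g on the convex hull of the
spectrum with exp g(t) = 1 + qu² - ut: two choices differ by a constant 2πin, and Tr_Γ(I) = |VB| is
an integer (`detΓ_affine`). In particular a scalar k ≠ 0 comes out of such a determinant as k^|VB|.

Functional equations: Δ(1/(qu)) = (qu²)⁻¹ Δ(u). Once (1-u²)^χ(B) has cancelled, each completed
function is p(u)^|VB| / det_Γ Δ(u), and p(1/(qu)) = ± p(u)/(qu²). For ξ and Ξ this is an identity of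
rational functions with sign +. For Λ the sign is -, and it comes from the principal square roots
(`sqrt_functional_equation`).

Euler product: if α + β = t and αβ = q, then 1 + qu² - ut = (1-uα)(1-uβ), so -log det_Γ Δ(u) = Σ
u^m/m · Tr_Γ D_m(A), where the Dickson polynomial D_m evaluates to α^m + β^m
(`exists_hasSum_powerTrace`). On the other side the logarithm of the product is Σ u^m/m · N_m, where
N_m counts the Γ-orbits of reduced closed paths of length m: a class of prime cycles C of length ℓ
contributes ℓ/|Γ_C| orbits if ℓ divides m and none otherwise (`PrimeClass.count_mul_cardStab`).

The two sides meet in `sum_reducedWalks`: N_m = Tr_Γ D_m(A), plus (q-1)|VB| when m is even. Walks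
without backtracking are counted by polynomials A_m(A). Cutting the end edges off closed walks with
a tail gives N_m - N_{m-2} = Tr_Γ(A_m(A) - q A_{m-2}(A)), and A_m - q A_{m-2} = D_m - D_{m-2} for m
≥ 3 (`walkPoly_sub`). The even terms sum to -(q-1)|VB|/2 · log(1-u²) = χ(B) log(1-u²), which is the
remaining factor of the zeta function. -/

noncomputable section

namespace IharaPeriodic

section

open Complex Metric Set

/-! ### The analytic determinant through the continuous functional calculus -/

section trace

variable {V : Type*} (G : SimpleGraph V) (Γ : Subgroup (G ≃g G))

open Classical in
/-- The trace `traceΓ` as a continuous linear functional. -/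
def traceCLM [Finite (MulAction.orbitRel.Quotient Γ V)] : (L2 V →L[ℂ] L2 V) →L[ℂ] ℂ :=
  letI := Fintype.ofFinite (MulAction.orbitRel.Quotient Γ V)
  ∑ o : MulAction.orbitRel.Quotient Γ V,
    (innerSL ℂ (lp.single 2 (Quotient.out o) 1 : L2 V)).comp
      (ContinuousLinearMap.apply ℂ (L2 V) (lp.single 2 (Quotient.out o) 1 : L2 V))

variable [Finite (MulAction.orbitRel.Quotient Γ V)]

theorem traceCLM_apply (T : L2 V →L[ℂ] L2 V) : traceCLM G Γ T = traceΓ G Γ T := by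
  classical
  let _ := Fintype.ofFinite (MulAction.orbitRel.Quotient Γ V)
  rw [traceΓ, finsum_eq_sum_of_fintype, traceCLM, sum_apply]
  refine Finset.sum_congr rfl fun o _ => ?_
  simp only [ContinuousLinearMap.comp_apply, ContinuousLinearMap.apply_apply, innerSL_apply_apply]
  rw [lp.inner_single_left]
  simp

theorem traceCLM_one : traceCLM G Γ 1 = cardVB G Γ := by
  classical
  let _ := Fintype.ofFinite (MulAction.orbitRel.Quotient Γ V)
  rw [traceCLM_apply, traceΓ, finsum_eq_sum_of_fintype]
  simp [cardVB, Nat.card_eq_fintype_card]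

end trace

/-- The branch of the logarithm on the disc `|w - c| < |c|` used in `logOnDisc`. -/
def logBranch (c w : ℂ) : ℂ := Complex.log c + Complex.log (w / c)

theorem div_mem_slitPlane {c w : ℂ} (h : dist w c < ‖c‖) : w / c ∈ slitPlane := by
  have hc : 0 < ‖c‖ := dist_nonneg.trans_lt h
  have hc0 : c ≠ 0 := norm_pos_iff.1 hc
  have h1 : ‖w / c - 1‖ < 1 := by
    rw [div_sub_one hc0, norm_div, div_lt_one hc, ← dist_eq_norm]
    exact h
  have := mem_slitPlane_of_norm_lt_one h1
  simpa using this

theorem differentiableAt_logBranch {c w : ℂ} (h : dist w c < ‖c‖) :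
    DifferentiableAt ℂ (logBranch c) w := by
  unfold logBranch
  exact ((differentiableAt_id.div_const c).clog (div_mem_slitPlane h)).const_add _

theorem exp_logBranch {c w : ℂ} (h : dist w c < ‖c‖) : Complex.exp (logBranch c w) = w := by
  have hc0 : c ≠ 0 := norm_pos_iff.1 (dist_nonneg.trans_lt h)
  rw [logBranch, Complex.exp_add, Complex.exp_log hc0,
    Complex.exp_log (slitPlane_ne_zero (div_mem_slitPlane h)), mul_div_cancel₀ _ hc0]

theorem resolvent_eq_cfc {V : Type*} {T : L2 V →L[ℂ] L2 V} (hT : IsStarNormal T) {z : ℂ}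
    (hz : z ∉ spectrum ℂ T) : resolvent T z = cfc (fun w => (z - w)⁻¹) T := by
  rw [cfc_inv (fun w => z - w) T (fun w hw h => hz (by rwa [sub_eq_zero.1 h])),
    cfc_sub (fun _ => z) (fun w => w) T, cfc_const z T, cfc_id' ℂ T, resolvent]

/-- On the contour the resolvent is the functional calculus of w ↦ (z-w)⁻¹. The functional calculus
commutes with the contour integral, and the resulting scalar integral is Cauchy's formula for the
logarithm. -/
theorem logOnDisc_eq_cfc {V : Type*} {T : L2 V →L[ℂ] L2 V} (hT : IsStarNormal T) {c : ℂ} {r : ℝ}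
    (hr : 0 < r) (hrc : r < ‖c‖) (hσ : spectrum ℂ T ⊆ ball c r) :
    logOnDisc T c r = cfc (logBranch c) T := by
  -- The contour stays off the spectrum, so the integrand is jointly continuous and bounded there.
  have hne : ∀ θ : ℝ, ∀ w ∈ spectrum ℂ T, circleMap c r θ - w ≠ 0 := fun θ w hw h => by
    have h1 := hσ hw
    rw [← sub_eq_zero.1 h, mem_ball] at h1
    have h2 := circleMap_mem_sphere c hr.le θ
    rw [mem_sphere] at h2
    exact absurd h1 (by rw [h2]; exact lt_irrefl r)
  have hcirc : ∀ θ : ℝ, dist (circleMap c r θ) c < ‖c‖ := fun θ => by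
    have h2 := circleMap_mem_sphere c hr.le θ
    rw [mem_sphere] at h2
    rwa [h2]
  have hcl : Continuous fun θ : ℝ => logBranch c (circleMap c r θ) :=
    continuous_iff_continuousAt.2 fun θ =>
      (differentiableAt_logBranch (hcirc θ)).continuousAt.comp
        (continuous_circleMap c r).continuousAt
  have hcont : ContinuousOn (Function.uncurry fun (θ : ℝ) (w : ℂ) =>
      deriv (circleMap c r) θ * (logBranch c (circleMap c r θ) * (circleMap c r θ - w)⁻¹))
      (univ ×ˢ spectrum ℂ T) := by
    refine ContinuousOn.mul ?_ (ContinuousOn.mul ?_ (ContinuousOn.inv₀ ?_ ?_))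
    · simp only [deriv_circleMap]
      fun_prop
    · exact (hcl.comp continuous_fst).continuousOn
    · fun_prop
    · rintro ⟨θ, w⟩ ⟨-, hw⟩
      exact hne θ w hw
  obtain ⟨M, hM⟩ := ((isCompact_Icc (a := (0 : ℝ)) (b := 2 * Real.pi)).prod
    (spectrum.isCompact (𝕜 := ℂ) T)).exists_bound_of_continuousOn
      (hcont.mono (prod_mono (subset_univ _) subset_rfl))
  have hscalar : ∀ w ∈ spectrum ℂ T, (2 * Real.pi * I : ℂ)⁻¹ *
      ∫ θ in Ioc 0 (2 * Real.pi),
        deriv (circleMap c r) θ * (logBranch c (circleMap c r θ) * (circleMap c r θ - w)⁻¹)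
      = logBranch c w := fun w hw => by
    have hd : DifferentiableOn ℂ (logBranch c) (closedBall c r) := fun z hz =>
      (differentiableAt_logBranch (lt_of_le_of_lt hz hrc)).differentiableWithinAt
    have := hd.circleIntegral_sub_inv_smul (hσ hw)
    rw [← intervalIntegral.integral_of_le Real.two_pi_pos.le, inv_mul_eq_iff_eq_mul₀
      Complex.two_pi_I_ne_zero, ← smul_eq_mul (a := 2 * (Real.pi : ℂ) * I), ← this, circleIntegral]
    refine intervalIntegral.integral_congr fun θ _ => ?_
    simp only [smul_eq_mul]
    ring
  rw [← cfc_congr hscalar, cfc_const_mul _ _ _ ?_, cfc_setIntegral measurableSet_Ioc _ (fun _ => M) T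
    (hcont.mono (prod_mono (subset_univ _) subset_rfl)) ?_ ?_ hT, logOnDisc, circleIntegral,
    intervalIntegral.integral_of_le Real.two_pi_pos.le]
  · congr 1
    refine MeasureTheory.integral_congr_ae (Filter.Eventually.of_forall fun θ => ?_)
    have hz : circleMap c r θ ∉ spectrum ℂ T := fun h => hne θ _ h (sub_self _)
    have hc1 : ContinuousOn (fun w => (circleMap c r θ - w)⁻¹) (spectrum ℂ T) :=
      ContinuousOn.inv₀ (by fun_prop) fun w hw => hne θ w hw
    simp only
    simp only [← mul_assoc]
    rw [resolvent_eq_cfc hT hz, cfc_const_mul _ _ _ hc1, mul_smul]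
    rfl
  · exact (MeasureTheory.ae_restrict_mem measurableSet_Ioc).mono fun θ hθ w hw =>
      hM (θ, w) ⟨Ioc_subset_Icc_self hθ, hw⟩
  · exact (MeasureTheory.hasFiniteIntegral_const M)
  · exact ContinuousOn.congr (f := fun w => (2 * Real.pi * I : ℂ) * logBranch c w)
      (fun w hw => ((differentiableAt_logBranch
        (lt_trans (hσ hw) hrc)).continuousAt.continuousWithinAt).const_mul _)
      fun w hw => by
        simp only
        rw [← hscalar w hw, mul_inv_cancel_left₀ Complex.two_pi_I_ne_zero]

end

/-! ### Determinants of affine functions of a normal operator -/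

section

open Complex Metric Set

/-- Two continuous logarithms of the same function on a preconnected set differ by a constant
multiple of `2πi`. -/
theorem exists_int_of_exp_eq_one {S : Set ℂ} (hS : IsPreconnected S) {h : ℂ → ℂ}
    (hc : ContinuousOn h S) (h1 : ∀ x ∈ S, Complex.exp (h x) = 1) :
    ∃ n : ℤ, ∀ x ∈ S, h x = n * (2 * Real.pi * I) := by
  -- The function Im h / 2π is continuous with values in the discrete set ℤ ⊂ ℝ, hence constant on a
  -- preconnected set.
  have hT : IsDiscrete (range ((↑) : ℤ → ℝ)) :=
    ⟨(Int.isClosedEmbedding_coe_real.isEmbedding.toHomeomorph.symm).isEmbedding.discreteTopology⟩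
  have hval : ∀ x ∈ S, ∃ n : ℤ, h x = n * (2 * Real.pi * I) := fun x hx =>
    Complex.exp_eq_one_iff.1 (h1 x hx)
  have him : ∀ n : ℤ, ((n * (2 * Real.pi * I) : ℂ)).im / (2 * Real.pi) = n := fun n => by
    simp
  obtain ⟨y, ⟨n, rfl⟩, hy⟩ := hS.eqOn_const_of_mapsTo hT
    (f := fun x => (h x).im / (2 * Real.pi))
    ((Complex.continuous_im.comp_continuousOn hc).div_const _)
    (fun x hx => by
      obtain ⟨n, hn⟩ := hval x hx
      exact ⟨n, by simp only [hn, him]⟩) (range_nonempty _)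
  refine ⟨n, fun x hx => ?_⟩
  obtain ⟨m, hm⟩ := hval x hx
  have := hy hx
  simp only [hm, him, Function.const_apply, Int.cast_inj] at this
  rw [hm, this]

section affine

variable {V : Type*} {A : L2 V →L[ℂ] L2 V} {a u : ℂ}

theorem affine_eq_cfc (hA : IsStarNormal A) (a u : ℂ) :
    a • (1 : L2 V →L[ℂ] L2 V) - u • A = cfc (fun t => a - u * t) A := by
  rw [cfc_sub (fun _ => a) (fun t => u * t) A, cfc_const a A, cfc_const_mul_id u A,
    Algebra.algebraMap_eq_smul_one]

theorem spectrum_affine (hA : IsStarNormal A) (a u : ℂ) :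
    spectrum ℂ (a • (1 : L2 V →L[ℂ] L2 V) - u • A) = (fun t => a - u * t) '' spectrum ℂ A := by
  rw [affine_eq_cfc hA, cfc_map_spectrum (fun t => a - u * t) A]

theorem convexHull_affine_image (s : Set ℂ) (a u : ℂ) :
    convexHull ℝ ((fun t => a - u * t) '' s) = (fun t => a - u * t) '' convexHull ℝ s :=
  ((AffineMap.const ℝ ℂ a - (LinearMap.mulLeft ℝ u).toAffineMap).image_convexHull s).symm

theorem exists_continuousOn_log_affine (hA : IsStarNormal A)
    (h : InDetDomain (a • (1 : L2 V →L[ℂ] L2 V) - u • A)) :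
    ∃ g : ℂ → ℂ, ContinuousOn g (convexHull ℝ (spectrum ℂ A)) ∧
      ∀ t ∈ convexHull ℝ (spectrum ℂ A), Complex.exp (g t) = a - u * t := by
  obtain ⟨D, hD, -, hD2⟩ := h.exists_disc
  rw [spectrum_affine hA, convexHull_affine_image] at hD
  have hd : ∀ t ∈ convexHull ℝ (spectrum ℂ A), dist (a - u * t) D.1 < ‖D.1‖ := fun t ht =>
    (mem_ball.1 (hD ⟨t, ht, rfl⟩)).trans hD2
  refine ⟨fun t => logBranch D.1 (a - u * t), fun t ht => ?_, fun t ht => exp_logBranch (hd t ht)⟩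
  refine ContinuousAt.continuousWithinAt ?_
  exact ContinuousAt.comp (f := fun t => a - u * t) (g := logBranch D.1)
    (differentiableAt_logBranch (hd t ht)).continuousAt (by fun_prop)

variable (G : SimpleGraph V) (Γ : Subgroup (G ≃g G)) [Finite (MulAction.orbitRel.Quotient Γ V)]

/-- The analytic determinant may be computed from any continuous logarithm on the convex hull of
the spectrum. -/
theorem detΓ_affine (hA : IsStarNormal A)
    (h : InDetDomain (a • (1 : L2 V →L[ℂ] L2 V) - u • A)) {g : ℂ → ℂ}
    (hg : ContinuousOn g (convexHull ℝ (spectrum ℂ A)))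
    (hexp : ∀ t ∈ convexHull ℝ (spectrum ℂ A), Complex.exp (g t) = a - u * t) :
    detΓ G Γ (a • 1 - u • A) = Complex.exp (traceCLM G Γ (cfc g A)) := by
  have hT : IsStarNormal (a • (1 : L2 V →L[ℂ] L2 V) - u • A) := by
    rw [affine_eq_cfc hA]
    exact cfc_predicate _ A
  rw [detΓ, dif_pos h]
  obtain ⟨hD, hD1, hD2⟩ := h.exists_disc.choose_spec
  set D := h.exists_disc.choose
  have hsub := subset_convexHull ℝ (spectrum ℂ A)
  have hd : ∀ t ∈ convexHull ℝ (spectrum ℂ A), dist (a - u * t) D.1 < ‖D.1‖ := fun t ht => by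
    rw [spectrum_affine hA, convexHull_affine_image] at hD
    exact (mem_ball.1 (hD ⟨t, ht, rfl⟩)).trans hD2
  have hcomp : ContinuousOn (fun t => logBranch D.1 (a - u * t)) (convexHull ℝ (spectrum ℂ A)) :=
    fun t ht => ContinuousAt.continuousWithinAt
      (ContinuousAt.comp (f := fun t => a - u * t) (g := logBranch D.1)
        (differentiableAt_logBranch (hd t ht)).continuousAt (by fun_prop))
  -- The convex hull is connected, which the spectrum need not be; this makes the integer n the same
  -- at all points.
  obtain ⟨n, hn⟩ := exists_int_of_exp_eq_one (convex_convexHull ℝ (spectrum ℂ A)).isPreconnected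
    (hcomp.sub hg) fun t ht => by
      have h0 : a - u * t ≠ 0 := by
        rw [← hexp t ht]
        exact Complex.exp_ne_zero _
      simp only [Pi.sub_apply]
      rw [Complex.exp_sub, exp_logBranch (hd t ht), hexp t ht, div_self h0]
  rw [logOnDisc_eq_cfc hT hD1 hD2 ((subset_convexHull ℝ _).trans hD), affine_eq_cfc hA,
    ← cfc_comp' (logBranch D.1) (fun t => a - u * t) A ?_,
    cfc_congr (g := fun t => g t + n * (2 * Real.pi * I)) fun t ht => ?_,
    cfc_add_const _ _ _ (hg.mono hsub), ← traceCLM_apply, map_add, Algebra.algebraMap_eq_smul_one,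
    map_smul, traceCLM_one, Complex.exp_add]
  -- The ambiguity in the logarithm contributes exp(2πi n |VB|) = 1, because the trace of the
  -- identity is an integer.
  · have : ((n : ℂ) * (2 * Real.pi * I)) • (cardVB G Γ : ℂ)
        = ((n * cardVB G Γ : ℤ) : ℂ) * (2 * Real.pi * I) := by
      push_cast
      rw [smul_eq_mul]
      ring
    rw [this, Complex.exp_int_mul_two_pi_mul_I, mul_one]
  · have := hn t (hsub ht)
    simp only [Pi.sub_apply] at this
    simp only [← this]
    ring
  · rintro _ ⟨t, ht, rfl⟩
    exact (differentiableAt_logBranch (hd t (hsub ht))).continuousAt.continuousWithinAt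

/-- If g is a logarithm for a - ut, then log k + g is one for k(a - ut), and the constant log k has
trace |VB| log k. -/
theorem detΓ_affine_mul (hA : IsStarNormal A) {k : ℂ} (hk : k ≠ 0)
    (h : InDetDomain (a • (1 : L2 V →L[ℂ] L2 V) - u • A))
    (h' : InDetDomain ((k * a) • (1 : L2 V →L[ℂ] L2 V) - (k * u) • A)) :
    detΓ G Γ ((k * a) • 1 - (k * u) • A) = k ^ cardVB G Γ * detΓ G Γ (a • 1 - u • A) := by
  obtain ⟨g, hg, hexp⟩ := exists_continuousOn_log_affine hA h
  rw [detΓ_affine G Γ hA h hg hexp, detΓ_affine G Γ hA h' (g := fun t => Complex.log k + g t)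
    (continuousOn_const.add hg) fun t ht => ?_, cfc_const_add _ _ _
    (hg.mono (subset_convexHull ℝ _)), map_add, Algebra.algebraMap_eq_smul_one, map_smul,
    traceCLM_one, Complex.exp_add, smul_eq_mul, mul_comm (Complex.log k), Complex.exp_nat_mul,
    Complex.exp_log hk]
  rw [Complex.exp_add, Complex.exp_log hk, hexp t ht]
  ring

theorem detΓ_affine_ne_zero (hA : IsStarNormal A)
    (h : InDetDomain (a • (1 : L2 V →L[ℂ] L2 V) - u • A)) : detΓ G Γ (a • 1 - u • A) ≠ 0 := by
  obtain ⟨g, hg, hexp⟩ := exists_continuousOn_log_affine hA h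
  rw [detΓ_affine G Γ hA h hg hexp]
  exact Complex.exp_ne_zero _

end affine

/-! ### The adjacency operator and its spectrum -/

section adjacency

variable {V : Type*} (G : SimpleGraph V) [G.LocallyFinite] {d : ℕ} (hd : ∀ v, G.degree v ≤ d)

theorem adjOp_apply (f : L2 V) (x : V) : adjOp G hd f x = ∑ y ∈ G.neighborFinset x, f y := rfl

theorem norm_adjOp_le : ‖adjOp G hd‖ ≤ d :=
  LinearMap.mkContinuous_norm_le _ (by positivity) _

open Classical in
theorem adjOp_single (x : V) : adjOp G hd (lp.single 2 x 1)
    = ∑ y ∈ G.neighborFinset x, (lp.single 2 y 1 : L2 V) := by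
  ext y
  rw [adjOp_apply, lp.coeFn_sum, Finset.sum_apply]
  simp [Pi.single_apply, G.adj_comm]

/-- Adjacency is symmetric: pairing the adjoint with δ_x moves A onto δ_x, which becomes the sum of
δ_y over the neighbours y of x. -/
theorem isSelfAdjoint_adjOp : IsSelfAdjoint (adjOp G hd) := by
  classical
  rw [ContinuousLinearMap.isSelfAdjoint_iff']
  ext f x
  have h := lp.inner_single_left (𝕜 := ℂ) x (1 : ℂ)
    (ContinuousLinearMap.adjoint (adjOp G hd) f)
  rw [ContinuousLinearMap.adjoint_inner_right, adjOp_single, sum_inner] at h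
  simp only [lp.inner_single_left] at h
  simpa [adjOp_apply] using h.symm

/-- The spectrum of the adjacency operator lies in the real segment `[-d, d]`. -/
theorem convexHull_spectrum_adjOp_subset :
    convexHull ℝ (spectrum ℂ (adjOp G hd)) ⊆ {z : ℂ | z.im = 0 ∧ |z.re| ≤ d} := by
  refine convexHull_min (fun z hz => ?_) ?_
  · have h1 : z = z.re := (isSelfAdjoint_adjOp G hd).mem_spectrum_eq_re hz
    have h2 := spectrum.norm_le_norm_mul_of_mem hz
    refine ⟨by rw [h1]; simp, (Complex.abs_re_le_norm z).trans (h2.trans ?_)⟩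
    calc ‖adjOp G hd‖ * ‖(1 : L2 V →L[ℂ] L2 V)‖ ≤ d * 1 :=
          mul_le_mul (norm_adjOp_le G hd) ContinuousLinearMap.norm_id_le (norm_nonneg _)
            (by positivity)
      _ = d := mul_one _
  · have : {z : ℂ | z.im = 0 ∧ |z.re| ≤ d}
        = Complex.imLm ⁻¹' {0} ∩ Complex.reLm ⁻¹' Set.Icc (-(d : ℝ)) d := by
      ext z
      simp [abs_le]
    rw [this]
    exact ((convex_singleton (0 : ℝ)).linear_preimage _).inter
      ((convex_Icc _ _).linear_preimage _)

end adjacency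

end

section

open Complex Metric Set

/-! ### The region `Ω` -/

section Omega

variable {q : ℕ} {u : ℂ}

/-- For real t the imaginary part of the equation factors. Either u is real, and then |t| ≤ q + 1
forces (q|u|-1)(|u|-1) ≤ 0, so that 1/q ≤ |u| ≤ 1; or t = 2q Re u, and then the real part gives |u|²
= 1/q. `Omega` excludes exactly these two sets. -/
theorem delta_ne_zero (hq : 1 ≤ q) (hu : u ∈ Omega q) {t : ℂ} (ht : t.im = 0)
    (ht' : |t.re| ≤ q + 1) : 1 + q * u ^ 2 - u * t ≠ 0 := by
  intro h
  obtain ⟨h1, h2⟩ := hu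
  have hq0 : (1 : ℝ) ≤ q := by exact_mod_cast hq
  have hre := congrArg Complex.re h
  have him := congrArg Complex.im h
  simp only [pow_two, Complex.sub_re, Complex.add_re, Complex.one_re, Complex.mul_re,
    Complex.natCast_re, Complex.natCast_im, Complex.mul_im, ht, Complex.zero_re, Complex.sub_im,
    Complex.add_im, Complex.one_im, Complex.zero_im] at hre him
  have hy : u.im * (2 * q * u.re - t.re) = 0 := by linarith
  rcases mul_eq_zero.1 hy with hy | hy
  · refine h2 ⟨hy, ?_⟩
    rw [hy] at hre
    have h3 : 1 + q * |u.re| ^ 2 ≤ |u.re| * (q + 1) := by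
      rw [sq_abs]
      calc 1 + q * u.re ^ 2 = u.re * t.re := by linarith
        _ ≤ |u.re * t.re| := le_abs_self _
        _ = |u.re| * |t.re| := abs_mul _ _
        _ ≤ _ := by gcongr
    have h4 : (q * |u.re| - 1) * (|u.re| - 1) ≤ 0 := by linarith
    have h5 : |u.re| ≤ 1 := by
      by_contra hlt
      push Not at hlt
      have : 0 < (q * |u.re| - 1) * (|u.re| - 1) :=
        mul_pos (by nlinarith) (by linarith)
      linarith
    refine ⟨?_, h5⟩
    rw [div_le_iff₀ (by linarith)]
    by_contra hlt
    push Not at hlt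
    nlinarith
  · apply h1
    rw [eq_div_iff (by linarith)]
    have : t.re = 2 * q * u.re := by linarith
    rw [this] at hre
    linarith

theorem mem_Omega_of_norm_lt (hq : 1 ≤ q) (hu : ‖u‖ < 1 / q) : u ∈ Omega q := by
  have hq0 : (1 : ℝ) ≤ q := by exact_mod_cast hq
  refine ⟨?_, fun h => ?_⟩
  · rw [← Complex.sq_norm_sub_sq_re u]
    have h1 : (1 : ℝ) / q ≤ 1 := by
      rw [div_le_one (by linarith)]
      exact hq0
    have h2 : ‖u‖ ^ 2 < 1 / q := by nlinarith [norm_nonneg u]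
    intro h
    linarith
  · exact absurd ((Complex.abs_re_le_norm u).trans_lt hu) (not_lt.2 h.2.1)

theorem one_sub_sq_ne_zero_of_mem_Omega (hq : 1 ≤ q) (hu : u ∈ Omega q) : 1 - u ^ 2 ≠ 0 := by
  have hq0 : (1 : ℝ) ≤ q := by exact_mod_cast hq
  have h1 : (1 : ℝ) / q ≤ 1 := by
    rw [div_le_one (by linarith)]
    exact hq0
  intro h
  have : (1 - u) * (1 + u) = 0 := by linear_combination h
  apply hu.2
  rcases mul_eq_zero.1 this with h | h
  · rw [← sub_eq_zero.1 h]
    simpa using h1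
  · rw [← neg_eq_of_add_eq_zero_right h]
    simpa using h1

/-- The map u ↦ 1/(qu) preserves the circle |u|² = 1/q, and on the real line it sends |x| to
1/(q|x|), exchanging the ends 1/q and 1 of the removed segments. -/
theorem one_div_mem_Omega (hq : 1 ≤ q) (hu : u ∈ Omega q) (hu0 : u ≠ 0) :
    1 / (q * u) ∈ Omega q := by
  have hq0 : (0 : ℝ) < q := by exact_mod_cast hq
  have hn : 0 < u.re ^ 2 + u.im ^ 2 := by
    have := Complex.normSq_pos.2 hu0
    rw [Complex.normSq_apply] at this
    linarith
  have hre : (1 / (q * u) : ℂ).re = u.re / (q * (u.re ^ 2 + u.im ^ 2)) := by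
    rw [one_div, mul_inv, ← Complex.ofReal_natCast, ← Complex.ofReal_inv, Complex.re_ofReal_mul,
      Complex.inv_re, Complex.normSq_apply]
    field_simp
  have him : (1 / (q * u) : ℂ).im = -u.im / (q * (u.re ^ 2 + u.im ^ 2)) := by
    rw [one_div, mul_inv, ← Complex.ofReal_natCast, ← Complex.ofReal_inv, Complex.im_ofReal_mul,
      Complex.inv_im, Complex.normSq_apply]
    field_simp
  obtain ⟨h1, h2⟩ := hu
  refine ⟨fun h => h1 ?_, fun h => h2 ?_⟩
  · rw [hre, him] at h
    field_simp at h
    rw [eq_div_iff hq0.ne']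
    nlinarith
  · rw [hre, him] at h
    obtain ⟨ha, hb, hc⟩ := h
    have hi : u.im = 0 := by
      rcases div_eq_zero_iff.1 ha with h | h
      · linarith
      · exact absurd h (by positivity)
    rw [hi] at hb hc hn
    have hpos : 0 < |u.re| := abs_pos.2 fun h => by simp [h] at hn
    have he : |u.re / (q * (u.re ^ 2 + 0 ^ 2))| = 1 / (q * |u.re|) := by
      rw [abs_div, abs_mul, abs_of_pos hq0, abs_of_pos hn, ← sq_abs u.re]
      field_simp
      ring
    rw [he] at hb hc
    refine ⟨hi, ?_, ?_⟩
    · rw [div_le_iff₀ (by positivity)] at hc ⊢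
      linarith
    · rw [div_le_div_iff₀ (by positivity) (by positivity)] at hb
      nlinarith

end Omega

/-! ### Principal square roots under u ↦ 1/(qu) -/

section sqrt

theorem cpow_half_sq (z : ℂ) : (z ^ (1 / 2 : ℂ)) ^ 2 = z := by
  simp

theorem cpow_half_of_nonneg {r : ℝ} (hr : 0 ≤ r) : (r : ℂ) ^ (1 / 2 : ℂ) = (√r : ℝ) := by
  rw [Real.sqrt_eq_rpow, Complex.ofReal_cpow hr]
  simp

theorem cpow_half_of_nonpos {r : ℝ} (hr : r ≤ 0) : (r : ℂ) ^ (1 / 2 : ℂ) = I * (√(-r) : ℝ) := by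
  rw [Complex.ofReal_cpow_of_nonpos hr, ← Complex.ofReal_neg, cpow_half_of_nonneg (by linarith),
    show (Real.pi : ℂ) * I * (1 / 2) = Real.pi / 2 * I by ring, Complex.exp_pi_div_two_mul_I,
    mul_comm]

/-- Taking principal logarithms of 1 + p = p(1 + 1/p) is additive here: the imaginary parts of p and
1 + 1/p have opposite signs, or both vanish with p > 0, so the arguments add up without leaving (-π,
π]. -/
theorem cpow_half_one_add {p : ℂ} (hp : p ∈ slitPlane) :
    (1 + p) ^ (1 / 2 : ℂ) = p ^ (1 / 2 : ℂ) * (1 + 1 / p) ^ (1 / 2 : ℂ) := by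
  have hp0 := slitPlane_ne_zero hp
  have hn : 0 < normSq p := normSq_pos.2 hp0
  have him : (1 + 1 / p).im = -p.im / normSq p := by
    rw [one_div, add_im, one_im, inv_im, zero_add]
  have hre : (1 + 1 / p).re = 1 + p.re / normSq p := by
    rw [one_div, add_re, one_re, inv_re]
  have he : 1 + p = p * (1 + 1 / p) := by
    field_simp
    ring
  rcases eq_or_ne (1 + 1 / p) 0 with h0 | h0
  · rw [he, h0]
    simp
  rw [he, Complex.cpow_def_of_ne_zero (mul_ne_zero hp0 h0), Complex.cpow_def_of_ne_zero hp0,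
    Complex.cpow_def_of_ne_zero h0, ← Complex.exp_add, ← add_mul,
    (Complex.log_mul_eq_add_log_iff hp0 h0).2 ?_]
  rcases lt_trichotomy p.im 0 with h | h | h
  · have h1 : 0 < (1 + 1 / p).im := by
      rw [him]
      exact div_pos (by linarith) hn
    have h2 := Complex.arg_neg_iff.2 h
    have h3 := Complex.neg_pi_lt_arg p
    have h4 := Complex.arg_nonneg_iff.2 h1.le
    have h5 := Complex.arg_le_pi (1 + 1 / p)
    constructor <;> linarith
  · have h1 : 0 < p.re := by
      rcases hp with h' | h'
      · exact h'
      · exact absurd h h'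
    have h2 : arg p = 0 := Complex.arg_eq_zero_iff.2 ⟨h1.le, h⟩
    have h3 : arg (1 + 1 / p) = 0 :=
      Complex.arg_eq_zero_iff.2 ⟨by rw [hre]; positivity, by rw [him, h]; simp⟩
    rw [h2, h3]
    constructor <;> linarith [Real.pi_pos]
  · have h1 : (1 + 1 / p).im < 0 := by
      rw [him]
      exact div_neg_of_neg_of_pos (by linarith) hn
    have h2 := Complex.arg_neg_iff.2 h1
    have h3 := Complex.neg_pi_lt_arg (1 + 1 / p)
    have h4 := Complex.arg_nonneg_iff.2 h.le
    have h5 := Complex.arg_le_pi p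
    constructor <;> linarith

variable {q : ℕ} {u : ℂ}

/-- With p = -u² the left side is the square root of 1 + p times that of 1 + q²p. Pulling out the
square roots of p and q²p leaves the factors at 1/(qu), in the other order, and p^(1/2) · q p^(1/2)
= qp = -qu². This fails to apply only when p is a negative real, that is, for real u. -/
theorem sqrt_functional_equation (hq : 1 ≤ q) (hu : u ∈ Omega q) (hu0 : u ≠ 0) :
    (1 - u ^ 2) ^ (1 / 2 : ℂ) * (1 - q ^ 2 * u ^ 2) ^ (1 / 2 : ℂ)
      = -(q * u ^ 2) * ((1 - (1 / (q * u)) ^ 2) ^ (1 / 2 : ℂ)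
        * (1 - q ^ 2 * (1 / (q * u)) ^ 2) ^ (1 / 2 : ℂ)) := by
  have hq1 : (1 : ℝ) ≤ q := by exact_mod_cast hq
  have hqpos : (0 : ℝ) < q := by linarith
  have hq0 : (q : ℂ) ≠ 0 := by exact_mod_cast (by omega : q ≠ 0)
  by_cases hp : -u ^ 2 ∈ slitPlane
  · have hlog : Complex.log (((q ^ 2 : ℝ) : ℂ) * -u ^ 2)
        = Real.log (q ^ 2) + Complex.log (-u ^ 2) :=
      Complex.log_ofReal_mul (by positivity) (slitPlane_ne_zero hp)
    have hp2 : ((q ^ 2 : ℝ) : ℂ) * -u ^ 2 ∈ slitPlane := by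
      rw [mem_slitPlane_iff] at hp ⊢
      rw [re_ofReal_mul, im_ofReal_mul]
      exact hp.imp (fun h => by positivity) fun h => mul_ne_zero (by positivity) h
    have hs : (((q ^ 2 : ℝ) : ℂ) * -u ^ 2) ^ (1 / 2 : ℂ) = q * (-u ^ 2) ^ (1 / 2 : ℂ) := by
      rw [Complex.cpow_def_of_ne_zero (slitPlane_ne_zero hp2), hlog, add_mul, Complex.exp_add,
        ← Complex.cpow_def_of_ne_zero (slitPlane_ne_zero hp), Complex.ofReal_log (by positivity),
        ← Complex.cpow_def_of_ne_zero (by exact_mod_cast (pow_pos hqpos 2).ne'),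
        cpow_half_of_nonneg (by positivity), Real.sqrt_sq hqpos.le, Complex.ofReal_natCast]
    have e1 := cpow_half_one_add hp
    have e2 := cpow_half_one_add hp2
    rw [hs] at e2
    rw [show 1 - u ^ 2 = 1 + -u ^ 2 by ring, e1,
      show 1 - q ^ 2 * u ^ 2 = 1 + ((q ^ 2 : ℝ) : ℂ) * -u ^ 2 by push_cast; ring, e2,
      show 1 - (1 / (q * u)) ^ 2 = 1 + 1 / (((q ^ 2 : ℝ) : ℂ) * -u ^ 2) by
        push_cast
        field_simp
        ring,
      show 1 - q ^ 2 * (1 / (q * u)) ^ 2 = 1 + 1 / (-u ^ 2) by field_simp; ring]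
    linear_combination (q : ℂ) * (1 + 1 / (-u ^ 2)) ^ (1 / 2 : ℂ)
      * (1 + 1 / (((q ^ 2 : ℝ) : ℂ) * -u ^ 2)) ^ (1 / 2 : ℂ) * cpow_half_sq (-u ^ 2)
  · rw [mem_slitPlane_iff, not_or, not_not, not_lt] at hp
    obtain ⟨hre, him⟩ := hp
    simp only [pow_two, neg_re, neg_im, mul_re, mul_im] at hre him
    have hi : u.im = 0 := by
      by_contra hne
      have h0 : u.re = 0 := by
        have : u.re * u.im = 0 := by linarith
        exact (mul_eq_zero.1 this).resolve_right hne
      rw [h0] at hre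
      nlinarith [mul_self_pos.2 hne]
    obtain ⟨x, rfl⟩ : ∃ x : ℝ, u = x := ⟨u.re, by apply Complex.ext <;> simp [hi]⟩
    have hx0 : x ≠ 0 := by simpa using hu0
    have hs : 0 < x ^ 2 := by positivity
    -- For real u, membership in `Omega` leaves two intervals. On each of them both radicands are
    -- nonnegative on one side of the equation and nonpositive on the other, so the sign is I² = -1.
    have hcase : q ^ 2 * x ^ 2 < 1 ∨ 1 < x ^ 2 := by
      by_contra hcon
      push Not at hcon
      refine hu.2 ⟨by simp, ?_, ?_⟩
      · rw [ofReal_re, div_le_iff₀ hqpos]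
        refine (pow_le_pow_iff_left₀ zero_le_one (by positivity) two_ne_zero).1 ?_
        rw [mul_pow, sq_abs]
        linarith [hcon.1]
      · rw [ofReal_re]
        refine (pow_le_pow_iff_left₀ (abs_nonneg _) zero_le_one two_ne_zero).1 ?_
        rw [sq_abs]
        linarith [hcon.2]
    have hx2 : x ^ 2 ≤ q ^ 2 * x ^ 2 := le_mul_of_one_le_left hs.le (one_le_pow₀ hq1)
    rw [show (1 : ℂ) - (x : ℂ) ^ 2 = ((1 - x ^ 2 : ℝ) : ℂ) by push_cast; ring,
      show (1 : ℂ) - q ^ 2 * (x : ℂ) ^ 2 = ((1 - q ^ 2 * x ^ 2 : ℝ) : ℂ) by push_cast; ring,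
      show (1 : ℂ) - (1 / (q * x)) ^ 2 = ((1 - 1 / (q ^ 2 * x ^ 2) : ℝ) : ℂ) by
        push_cast
        ring,
      show (1 : ℂ) - q ^ 2 * (1 / (q * x)) ^ 2 = ((1 - 1 / x ^ 2 : ℝ) : ℂ) by
        push_cast
        field_simp]
    rcases hcase with h | h
    · have a1 : 1 ≤ 1 / (q ^ 2 * x ^ 2) := by
        rw [le_div_iff₀ (by positivity)]
        linarith
      have a2 : 1 ≤ 1 / x ^ 2 := by
        rw [le_div_iff₀ (by positivity)]
        linarith
      rw [cpow_half_of_nonneg (by linarith), cpow_half_of_nonneg (by linarith),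
        cpow_half_of_nonpos (by linarith), cpow_half_of_nonpos (by linarith)]
      have : √(1 - x ^ 2) * √(1 - q ^ 2 * x ^ 2)
          = q * x ^ 2 * (√(-(1 - 1 / (q ^ 2 * x ^ 2))) * √(-(1 - 1 / x ^ 2))) := by
        rw [← Real.sqrt_mul (by linarith), ← Real.sqrt_mul (by linarith),
          ← Real.sqrt_sq (by positivity : 0 ≤ q * x ^ 2), ← Real.sqrt_mul (by positivity)]
        congr 1
        field_simp
        ring
      have := congrArg (fun r : ℝ => (r : ℂ)) this
      push_cast at this ⊢
      rw [this]
      linear_combination (q * x ^ 2 * (√(-(1 - 1 / (q ^ 2 * x ^ 2))) * √(-(1 - 1 / x ^ 2))) : ℂ)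
        * Complex.I_sq
    · have a1 : 1 / (q ^ 2 * x ^ 2) ≤ 1 := by
        rw [div_le_iff₀ (by positivity)]
        linarith
      have a2 : 1 / x ^ 2 ≤ 1 := by
        rw [div_le_iff₀ (by positivity)]
        linarith
      rw [cpow_half_of_nonpos (by linarith), cpow_half_of_nonpos (by linarith),
        cpow_half_of_nonneg (by linarith), cpow_half_of_nonneg (by linarith)]
      have : √(-(1 - x ^ 2)) * √(-(1 - q ^ 2 * x ^ 2))
          = q * x ^ 2 * (√(1 - 1 / (q ^ 2 * x ^ 2)) * √(1 - 1 / x ^ 2)) := by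
        rw [← Real.sqrt_mul (by linarith), ← Real.sqrt_mul (by linarith),
          ← Real.sqrt_sq (by positivity : 0 ≤ q * x ^ 2), ← Real.sqrt_mul (by positivity)]
        congr 1
        field_simp
        ring
      have := congrArg (fun r : ℝ => (r : ℂ)) this
      push_cast at this ⊢
      linear_combination (-1 : ℂ) * this
        + (√(-(1 - x ^ 2)) * √(-(1 - q ^ 2 * x ^ 2)) : ℂ) * Complex.I_sq

end sqrt

/-! ### The functional equations -/

section functional

variable {V : Type*} (G : SimpleGraph V) [G.LocallyFinite] {q : ℕ}
  (hreg : G.IsRegularOfDegree (q + 1)) {u : ℂ}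

theorem inDetDomain_deltaOp (hq : 1 ≤ q) (hu : u ∈ Omega q) : InDetDomain (deltaOp G hreg u) := by
  rw [InDetDomain, deltaOp, spectrum_affine (isSelfAdjoint_adjOp G _).isStarNormal,
    convexHull_affine_image]
  rintro ⟨t, ht, h⟩
  have := convexHull_spectrum_adjOp_subset G _ ht
  exact delta_ne_zero hq hu this.1 (by simpa using this.2) h

theorem cpow_neg_mul_zeta (Γ : Subgroup (G ≃g G)) (hq : 1 ≤ q) (hu : u ∈ Omega q) :
    (1 - u ^ 2) ^ (-(eulerChar G Γ : ℂ)) * zeta G hreg Γ u = (detΓ G Γ (deltaOp G hreg u))⁻¹ := by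
  rw [zeta, ← mul_assoc, ← Complex.cpow_add _ _ (one_sub_sq_ne_zero_of_mem_Omega hq hu),
    neg_add_cancel, Complex.cpow_zero, one_mul]

variable (Γ : Subgroup (G ≃g G)) [Finite (MulAction.orbitRel.Quotient Γ V)]

theorem detΓ_deltaOp_ne_zero (hq : 1 ≤ q) (hu : u ∈ Omega q) :
    detΓ G Γ (deltaOp G hreg u) ≠ 0 :=
  detΓ_affine_ne_zero G Γ (isSelfAdjoint_adjOp G _).isStarNormal (inDetDomain_deltaOp G hreg hq hu)

/-- This is homogeneity of the determinant applied to Δ(1/(qu)) = (qu²)⁻¹ Δ(u). -/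
theorem detΓ_deltaOp_inv (hq : 1 ≤ q) (hu : u ∈ Omega q) (hu0 : u ≠ 0) :
    (q * u ^ 2) ^ cardVB G Γ * detΓ G Γ (deltaOp G hreg (1 / (q * u)))
      = detΓ G Γ (deltaOp G hreg u) := by
  have hq0 : (q : ℂ) ≠ 0 := by exact_mod_cast (by omega : q ≠ 0)
  have hk' : (q * u ^ 2 : ℂ) ≠ 0 := mul_ne_zero hq0 (pow_ne_zero 2 hu0)
  have hk : (1 / (q * u ^ 2) : ℂ) ≠ 0 := one_div_ne_zero hk'
  have h2 := inDetDomain_deltaOp G hreg hq (one_div_mem_Omega hq hu hu0)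
  have e : deltaOp G hreg (1 / (q * u)) = (1 / (q * u ^ 2) * (1 + q * u ^ 2) : ℂ) • 1
      - (1 / (q * u ^ 2) * u : ℂ) • adjOp G (fun v => (hreg v).le) := by
    rw [deltaOp]
    congr 2
    · field_simp
      ring
    · field_simp
  rw [e] at h2 ⊢
  rw [detΓ_affine_mul G Γ (isSelfAdjoint_adjOp G _).isStarNormal hk
    (inDetDomain_deltaOp G hreg hq hu) h2, ← mul_assoc, ← mul_pow, mul_one_div_cancel hk',
    one_pow, one_mul, deltaOp]

theorem completedξ_functional_equation (hq : 1 ≤ q) (hu : u ∈ Omega q) (hu0 : u ≠ 0) :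
    completedξ G hreg Γ u = completedξ G hreg Γ (1 / (q * u)) := by
  have hq0 : (q : ℂ) ≠ 0 := by exact_mod_cast (by omega : q ≠ 0)
  -- On all of `Omega` the powers (1-v²)^(±χ(B)) cancel; what is left to compare is (1-v)(1-qv),
  -- which acquires the factor 1/(qu²) under inversion.
  have key : ∀ v ∈ Omega q, completedξ G hreg Γ v
      = ((1 - v) * (1 - q * v)) ^ cardVB G Γ * (detΓ G Γ (deltaOp G hreg v))⁻¹ := fun v hv => by
    rw [← cpow_neg_mul_zeta G hreg Γ hq hv, completedξ, mul_pow]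
    ring
  have hd := detΓ_deltaOp_ne_zero G hreg Γ hq (one_div_mem_Omega hq hu hu0)
  rw [key _ hu, key _ (one_div_mem_Omega hq hu hu0), ← detΓ_deltaOp_inv G hreg Γ hq hu hu0,
    mul_inv, ← mul_assoc, ← inv_pow, ← mul_pow]
  congr 2
  field_simp
  ring

theorem completedΞ_functional_equation (hq : 1 ≤ q) (hu : u ∈ Omega q) (hu0 : u ≠ 0) :
    completedΞ G hreg Γ u = completedΞ G hreg Γ (1 / (q * u)) := by
  have hq0 : (q : ℂ) ≠ 0 := by exact_mod_cast (by omega : q ≠ 0)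
  have key : ∀ v ∈ Omega q, completedΞ G hreg Γ v
      = (1 + q * v ^ 2) ^ cardVB G Γ * (detΓ G Γ (deltaOp G hreg v))⁻¹ := fun v hv => by
    rw [← cpow_neg_mul_zeta G hreg Γ hq hv, completedΞ]
    ring
  rw [key _ hu, key _ (one_div_mem_Omega hq hu hu0), ← detΓ_deltaOp_inv G hreg Γ hq hu hu0,
    mul_inv, ← mul_assoc, ← inv_pow, ← mul_pow]
  congr 2
  field_simp
  ring

theorem completedΛ_functional_equation (hq : 1 ≤ q) (hu : u ∈ Omega q) (hu0 : u ≠ 0) :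
    completedΛ G hreg Γ u = (-1) ^ cardVB G Γ * completedΛ G hreg Γ (1 / (q * u)) := by
  have hq0 : (q : ℂ) ≠ 0 := by exact_mod_cast (by omega : q ≠ 0)
  have hpow : ∀ z : ℂ, z ^ ((cardVB G Γ : ℂ) / 2) = (z ^ (1 / 2 : ℂ)) ^ cardVB G Γ := fun z => by
    rw [← Complex.cpow_nat_mul]
    congr 1
    ring
  have key : ∀ v ∈ Omega q, completedΛ G hreg Γ v
      = ((1 - v ^ 2) ^ (1 / 2 : ℂ) * (1 - q ^ 2 * v ^ 2) ^ (1 / 2 : ℂ)) ^ cardVB G Γ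
        * (detΓ G Γ (deltaOp G hreg v))⁻¹ := fun v hv => by
    rw [← cpow_neg_mul_zeta G hreg Γ hq hv, completedΛ, hpow, hpow, mul_pow]
    ring
  rw [key _ hu, key _ (one_div_mem_Omega hq hu hu0), ← detΓ_deltaOp_inv G hreg Γ hq hu hu0,
    sqrt_functional_equation hq hu hu0]
  generalize (1 - (1 / (q * u)) ^ 2) ^ (1 / 2 : ℂ)
    * (1 - q ^ 2 * (1 / (q * u)) ^ 2) ^ (1 / 2 : ℂ) = z
  generalize detΓ G Γ (deltaOp G hreg (1 / (q * u))) = d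
  have h : ((q : ℂ) * u ^ 2) ^ cardVB G Γ * (((q : ℂ) * u ^ 2) ^ cardVB G Γ)⁻¹ = 1 :=
    mul_inv_cancel₀ (pow_ne_zero _ (mul_ne_zero hq0 (pow_ne_zero 2 hu0)))
  rw [mul_pow, neg_pow, mul_inv]
  linear_combination (-1) ^ cardVB G Γ * z ^ cardVB G Γ * d⁻¹ * h

end functional

end

section

open Complex Metric Set Polynomial

/-! ### The power series of the logarithm of the determinant -/

section series

variable {q : ℕ} {u : ℂ}

theorem dickson_one_eval_add {α β a t : ℂ} (h1 : α + β = t) (h2 : α * β = a) (m : ℕ) :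
    (dickson 1 a m).eval t = α ^ m + β ^ m := by
  induction m using Nat.strong_induction_on with
  | _ m ih =>
    match m with
    | 0 =>
      rw [dickson_zero]
      simp
      norm_num
    | 1 => simp [h1]
    | m + 2 =>
      rw [dickson_add_two, eval_sub, eval_mul, eval_mul, ih (m + 1) (by omega), ih m (by omega),
        eval_X, eval_C, ← h1, ← h2]
      ring

theorem exists_roots (q : ℕ) (t : ℂ) : ∃ α β : ℂ, α + β = t ∧ α * β = q := by
  refine ⟨(t + (t ^ 2 - 4 * q) ^ (1 / 2 : ℂ)) / 2, (t - (t ^ 2 - 4 * q) ^ (1 / 2 : ℂ)) / 2, by ring,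
    ?_⟩
  linear_combination (-1 / 4) * cpow_half_sq (t ^ 2 - 4 * q)

/-- The inverse of a root α is a zero u of 1 + qu² - ut, and `delta_ne_zero` excludes zeros with |u|
< 1/q. -/
theorem norm_root_le (hq : 1 ≤ q) {t : ℂ} (ht : t.im = 0) (ht' : |t.re| ≤ q + 1) {α β : ℂ}
    (h1 : α + β = t) (h2 : α * β = q) : ‖α‖ ≤ q := by
  by_contra hlt
  push Not at hlt
  have hq0 : (0 : ℝ) < q := by exact_mod_cast hq
  have hα : α ≠ 0 := norm_pos_iff.1 (hq0.trans hlt)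
  have hu : ‖α⁻¹‖ < 1 / q := by
    rw [norm_inv, one_div]
    exact inv_strictAnti₀ hq0 hlt
  refine delta_ne_zero hq (mem_Omega_of_norm_lt hq hu) ht ht' ?_
  rw [← h1, ← h2]
  field_simp
  ring

theorem norm_dickson_eval_le (hq : 1 ≤ q) {t : ℂ} (ht : t.im = 0) (ht' : |t.re| ≤ q + 1) (m : ℕ) :
    ‖(dickson 1 (q : ℂ) m).eval t‖ ≤ 2 * q ^ m := by
  obtain ⟨α, β, h1, h2⟩ := exists_roots q t
  rw [dickson_one_eval_add h1 h2]
  have hα := norm_root_le hq ht ht' h1 h2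
  have hβ := norm_root_le hq ht ht' ((add_comm β α).trans h1) ((mul_comm β α).trans h2)
  calc ‖α ^ m + β ^ m‖ ≤ ‖α‖ ^ m + ‖β‖ ^ m := by
        rw [← norm_pow, ← norm_pow]
        exact norm_add_le _ _
    _ ≤ q ^ m + q ^ m := by gcongr
    _ = 2 * q ^ m := by ring

/-- The sum S is -log(1-uα) - log(1-uβ), where both logarithms expand because |α|, |β| ≤ q. -/
theorem hasSum_dickson (hq : 1 ≤ q) (hu : ‖u‖ < 1 / q) {t : ℂ} (ht : t.im = 0)
    (ht' : |t.re| ≤ q + 1) :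
    ∃ S, HasSum (fun m : ℕ => u ^ m / m * (dickson 1 (q : ℂ) m).eval t) S ∧
      Complex.exp (-S) = 1 + q * u ^ 2 - u * t := by
  obtain ⟨α, β, h1, h2⟩ := exists_roots q t
  have hq0 : (0 : ℝ) < q := by exact_mod_cast hq
  have hlt : ∀ γ : ℂ, ‖γ‖ ≤ q → ‖u * γ‖ < 1 := fun γ hγ => by
    rw [norm_mul]
    calc ‖u‖ * ‖γ‖ ≤ ‖u‖ * q := by gcongr
      _ < 1 / q * q := by gcongr
      _ = 1 := by field_simp
  have hα := hlt α (norm_root_le hq ht ht' h1 h2)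
  have hβ := hlt β (norm_root_le hq ht ht' ((add_comm β α).trans h1) ((mul_comm β α).trans h2))
  have hne : ∀ z : ℂ, ‖z‖ < 1 → 1 - z ≠ 0 := fun z hz h => by
    rw [← sub_eq_zero.1 h] at hz
    simp at hz
  refine ⟨_, ((hasSum_taylorSeries_neg_log hα).add (hasSum_taylorSeries_neg_log hβ)).congr_fun
    fun m => ?_, ?_⟩
  · rw [dickson_one_eval_add h1 h2]
    ring
  · rw [neg_add, neg_neg, neg_neg, Complex.exp_add, Complex.exp_log (hne _ hα),
      Complex.exp_log (hne _ hβ), ← h1, ← h2]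
    ring

variable {V : Type*} (G : SimpleGraph V) [G.LocallyFinite]
  (hreg : G.IsRegularOfDegree (q + 1)) (Γ : Subgroup (G ≃g G))
  [Finite (MulAction.orbitRel.Quotient Γ V)]

/-- The traces of the power sums `α^m + β^m`, where `α + β = A` and `αβ = q`. -/
def powerTrace (m : ℕ) : ℂ :=
  traceCLM G Γ (aeval (adjOp G fun v => (hreg v).le) (dickson 1 (q : ℂ) m))

theorem exists_hasSum_powerTrace (hq : 1 ≤ q) (hu : ‖u‖ < 1 / q) :
    ∃ S, HasSum (fun m : ℕ => u ^ m / m * powerTrace G hreg Γ m) S ∧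
      detΓ G Γ (deltaOp G hreg u) = Complex.exp (-S) := by
  have hq0 : (0 : ℝ) < q := by exact_mod_cast hq
  have hA := (isSelfAdjoint_adjOp G fun v => (hreg v).le).isStarNormal
  set A := adjOp G fun v => (hreg v).le with hAdef
  set K := convexHull ℝ (spectrum ℂ A)
  set f : ℕ → ℂ → ℂ := fun m t => u ^ m / m * (dickson 1 (q : ℂ) m).eval t with hf
  have hK : ∀ t ∈ K, t.im = 0 ∧ |t.re| ≤ q + 1 := fun t ht => by
    have := convexHull_spectrum_adjOp_subset G _ ht
    exact ⟨this.1, by simpa using this.2⟩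
  have hcont : ∀ m, Continuous (f m) := fun m => continuous_const.mul (Polynomial.continuous _)
  have hbound : ∀ m, ∀ t ∈ K, ‖f m t‖ ≤ 2 * (‖u‖ * q) ^ m := fun m t ht => by
    have h1 := norm_dickson_eval_le hq (hK t ht).1 (hK t ht).2 m
    have h2 : ‖u ^ m / (m : ℂ)‖ ≤ ‖u‖ ^ m := by
      rw [norm_div, norm_pow, Complex.norm_natCast]
      -- At m = 0 the coefficient is 0 because `x / 0 = 0`, so D_0 = 2 does not contribute to the
      -- series.
      rcases Nat.eq_zero_or_pos m with rfl | hm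
      · simp
      · exact div_le_self (by positivity) (by exact_mod_cast hm)
    calc ‖f m t‖ ≤ ‖u‖ ^ m * (2 * q ^ m) := by
          rw [hf, norm_mul]
          gcongr
      _ = _ := by ring
  have hsum : Summable fun m : ℕ => 2 * (‖u‖ * q) ^ m := by
    refine (summable_geometric_of_lt_one (by positivity) ?_).mul_left 2
    rwa [lt_div_iff₀ hq0] at hu
  have hunif := tendstoUniformlyOn_tsum hsum hbound
  have hg : ContinuousOn (fun t => ∑' m, f m t) K :=
    continuousOn_tsum (fun m => (hcont m).continuousOn) hsum hbound
  -- The series converges uniformly on the spectrum, so it may be summed inside the functional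
  -- calculus.
  have hcfc : HasSum (fun m => cfc (f m) A) (cfc (fun t => ∑' m, f m t) A) := by
    have := tendsto_cfc_fun (p := IsStarNormal) (a := A)
      (hunif.mono (subset_convexHull ℝ (spectrum ℂ A)))
      (Filter.Eventually.of_forall fun s =>
        (continuous_finsetSum s fun m _ => hcont m).continuousOn)
    refine this.congr fun s => ?_
    rw [← cfc_sum _ _ _ fun m _ => (hcont m).continuousOn]
    congr 1
    ext t
    simp
  have hterm : ∀ m, cfc (f m) A = (u ^ m / m : ℂ) • aeval A (dickson 1 (q : ℂ) m) := fun m => by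
    rw [hf, cfc_const_mul _ _ _ (Polynomial.continuous _).continuousOn, cfc_polynomial _ _ hA]
  refine ⟨_, ((traceCLM G Γ).hasSum hcfc).congr_fun fun m => ?_, ?_⟩
  · rw [hterm, map_smul, smul_eq_mul]
    rfl
  · rw [deltaOp, detΓ_affine G Γ hA
      (inDetDomain_deltaOp G hreg hq (mem_Omega_of_norm_lt hq hu)) (g := fun t => -∑' m, f m t)
      hg.neg fun t ht => ?_, cfc_neg, map_neg]
    obtain ⟨S, hS, hS'⟩ := hasSum_dickson hq hu (hK t ht).1 (hK t ht).2
    rw [hS.tsum_eq, hS']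

end series

end

section

open MulAction

/-! ### Counting orbits of free actions -/

section orbits

variable {H X Y ι : Type*} [Group H] [MulAction H X] [MulAction H Y]

/-- Let `f : X → Y` be equivariant, with `H` acting freely on `X`. The number of points in a fibre
of `f` is the number of orbits meeting it times the order of the stabilizer of the base point. -/
theorem card_fiber_eq (hfree : ∀ (h : H) (x : X), h • x = x → h = 1) {f : X → Y}
    (hf : ∀ (h : H) (x : X), f (h • x) = h • f x) {r : ι → Y} {cls : orbitRel.Quotient H X → ι}
    (hcls : ∀ (x : X) (i : ι), cls (Quotient.mk _ x) = i ↔ r i ∈ orbit H (f x)) (i : ι) :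
    Nat.card {x // f x = r i}
      = Nat.card {o // cls o = i} * Nat.card (stabilizer H (r i)) := by
  -- Each orbit over i has a point lying exactly above r i; the points of the fibre are then the
  -- translates of these by the stabilizer, without repetition since the action is free.
  have hrep : ∀ o : {o // cls o = i}, ∃ x : X, Quotient.mk _ x = o.1 ∧ f x = r i := by
    rintro ⟨o, ho⟩
    induction o using Quotient.inductionOn with
    | _ x =>
      obtain ⟨h, hh⟩ := (hcls x i).1 ho
      exact ⟨h • x, Quotient.sound ⟨h, rfl⟩, (hf h x).trans hh⟩
  choose s hs1 hs2 using hrep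
  rw [← Nat.card_prod]
  refine (Nat.card_eq_of_bijective
    (fun p : {o // cls o = i} × stabilizer H (r i) =>
      (⟨(p.2 : H) • s p.1, by rw [hf, hs2]; exact p.2.2⟩ : {x // f x = r i})) ⟨?_, ?_⟩).symm
  · rintro ⟨o, h⟩ ⟨o', h'⟩ heq
    have heq' : (h : H) • s o = (h' : H) • s o' := congrArg Subtype.val heq
    have ho : o = o' := by
      apply Subtype.ext
      rw [← hs1, ← hs1]
      refine Quotient.sound ⟨(h : H)⁻¹ * h', ?_⟩
      simp only [mul_smul]
      rw [← heq', inv_smul_smul]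
    subst ho
    have : (h : H)⁻¹ * h' = 1 := hfree _ (s o) (by rw [mul_smul, ← heq', inv_smul_smul])
    rw [Prod.mk.injEq]
    exact ⟨rfl, Subtype.ext (inv_mul_eq_one.1 this)⟩
  · rintro ⟨x, hx⟩
    have ho : cls (Quotient.mk _ x) = i := (hcls x i).2 (by rw [hx]; exact mem_orbit_self _)
    obtain ⟨h, hh⟩ := Quotient.exact (hs1 ⟨_, ho⟩).symm
    have hh' : h • s ⟨_, ho⟩ = x := hh
    refine ⟨(⟨_, ho⟩, ⟨h, ?_⟩), Subtype.ext hh⟩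
    rw [mem_stabilizer_iff, ← hs2 ⟨_, ho⟩, ← hf, hh', hx, hs2]

/-- The map on orbits induced by an equivariant map. -/
def orbitMap {f : X → Y} (hf : ∀ (h : H) (x : X), f (h • x) = h • f x) :
    orbitRel.Quotient H X → orbitRel.Quotient H Y :=
  Quotient.map f <| by
    rintro x y ⟨h, rfl⟩
    exact ⟨h, (hf h y).symm⟩

theorem orbitMap_mk_eq_iff {f : X → Y} (hf : ∀ (h : H) (x : X), f (h • x) = h • f x) (x : X)
    (o : orbitRel.Quotient H Y) :
    orbitMap hf (Quotient.mk _ x) = o ↔ Quotient.out o ∈ orbit H (f x) := by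
  constructor
  · rintro rfl
    exact Quotient.exact (Quotient.out_eq (Quotient.mk (orbitRel H Y) (f x)))
  · intro h
    rw [← Quotient.out_eq o]
    exact (Quotient.sound h).symm

theorem card_fiber_eq_of_free (hfree : ∀ (h : H) (y : Y), h • y = y → h = 1) {f : X → Y}
    (hf : ∀ (h : H) (x : X), f (h • x) = h • f x) (o : orbitRel.Quotient H Y) :
    Nat.card {x // f x = Quotient.out o} = Nat.card {p // orbitMap hf p = o} := by
  have hstab : stabilizer H (Quotient.out o) = ⊥ :=
    (Subgroup.eq_bot_iff_forall _).2 fun h hh => hfree h _ hh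
  rw [card_fiber_eq (fun h x hx => hfree h (f x) (by rw [← hf, hx])) hf
    (r := (Quotient.out : orbitRel.Quotient H Y → Y)) (orbitMap_mk_eq_iff hf) o, hstab,
    Subgroup.card_bot, mul_one]

/-- Every orbit in X meets the fibre over one of the finitely many representatives in Y. -/
theorem finite_orbits {f : X → Y} (hf : ∀ (h : H) (x : X), f (h • x) = h • f x)
    [Finite (orbitRel.Quotient H Y)] (hfin : ∀ y, Finite {x // f x = y}) :
    Finite (orbitRel.Quotient H X) := by
  refine Finite.of_surjective (fun p : Σ o : orbitRel.Quotient H Y, {x // f x = Quotient.out o} =>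
    (Quotient.mk _ p.2.1 : orbitRel.Quotient H X)) fun o => ?_
  induction o using Quotient.inductionOn with
  | _ x =>
    obtain ⟨h, hh⟩ := (orbitMap_mk_eq_iff hf x _).1 rfl
    exact ⟨⟨_, h • x, (hf h x).trans hh⟩, Quotient.sound ⟨h, rfl⟩⟩

/-- The number of orbits is the sum of the sizes of the fibres over representatives. -/
theorem card_orbits_eq_sum (hfree : ∀ (h : H) (y : Y), h • y = y → h = 1) {f : X → Y}
    (hf : ∀ (h : H) (x : X), f (h • x) = h • f x) [Fintype (orbitRel.Quotient H Y)]
    (hfin : ∀ y, Finite {x // f x = y}) :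
    Nat.card (orbitRel.Quotient H X)
      = ∑ o : orbitRel.Quotient H Y, Nat.card {x // f x = Quotient.out o} := by
  have := finite_orbits hf hfin
  simp only [card_fiber_eq_of_free hfree hf]
  rw [← Nat.card_sigma]
  exact (Nat.card_congr (Equiv.sigmaFiberEquiv _)).symm

end orbits

/-! ### The Euler characteristic of the quotient -/

section euler

variable {V : Type*} (G : SimpleGraph V) (Γ : Subgroup (G ≃g G))

theorem free_smul (hfree : ∀ γ ∈ Γ, γ ≠ 1 → ∀ v : V, γ v ≠ v) (γ : Γ) (v : V) (h : γ • v = v) : γ = 1 := by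
  by_contra hne
  exact hfree γ.1 γ.2 (fun h1 => hne (Subtype.ext h1)) v h

/-- The oriented edges, with the action of the automorphism group. -/
def orientedEdges : SubMulAction Γ (V × V) where
  carrier := {p | G.Adj p.1 p.2}
  smul_mem' γ _ h := γ.1.map_adj_iff.2 h

variable [G.LocallyFinite] {q : ℕ}

/-- Orbits of oriented edges are counted by their origin: above each vertex representative lie q + 1
edges. -/
theorem cardOrientedEB_eq (hreg : G.IsRegularOfDegree (q + 1))
    (hfree : ∀ γ ∈ Γ, γ ≠ 1 → ∀ v : V, γ v ≠ v) [Finite (MulAction.orbitRel.Quotient Γ V)] :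
    cardOrientedEB G Γ = cardVB G Γ * (q + 1) := by
  let _ := Fintype.ofFinite (MulAction.orbitRel.Quotient Γ V)
  have e : ∀ v : V, {x : orientedEdges G Γ // x.1.1 = v} ≃ G.neighborSet v := fun v =>
    { toFun := fun x => ⟨x.1.1.2, Eq.subst (motive := fun a => G.Adj a x.1.1.2) x.2 x.1.2⟩
      invFun := fun w => ⟨⟨(v, w), w.2⟩, rfl⟩
      left_inv := by
        rintro ⟨⟨⟨a, b⟩, h⟩, rfl⟩
        rfl
      right_inv := fun w => rfl }
  have h1 : cardOrientedEB G Γ = Nat.card (orbitRel.Quotient Γ (orientedEdges G Γ)) := by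
    refine Nat.card_congr (Quotient.congr (Equiv.refl _) fun x y => ?_)
    constructor
    · rintro ⟨γ, h⟩
      exact ⟨γ, Subtype.ext h⟩
    · rintro ⟨γ, h⟩
      exact ⟨γ, congrArg Subtype.val h⟩
  rw [h1, card_orbits_eq_sum (f := fun x : orientedEdges G Γ => x.1.1) (free_smul G Γ hfree)
    (fun _ _ => rfl) (fun v => Finite.of_equiv _ (e v).symm)]
  have : ∀ v, Nat.card {x : orientedEdges G Γ // x.1.1 = v} = q + 1 := fun v => by
    rw [Nat.card_congr (e v), Nat.card_eq_fintype_card, G.card_neighborSet_eq_degree, hreg v]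
  simp only [this, Finset.sum_const, smul_eq_mul, Finset.card_univ, cardVB,
    Nat.card_eq_fintype_card]

theorem eulerChar_eq (hreg : G.IsRegularOfDegree (q + 1))
    (hfree : ∀ γ ∈ Γ, γ ≠ 1 → ∀ v : V, γ v ≠ v) [Finite (MulAction.orbitRel.Quotient Γ V)] :
    (eulerChar G Γ : ℂ) = -((q - 1) * cardVB G Γ / 2) := by
  rw [eulerChar, cardOrientedEB_eq G Γ hreg hfree]
  push_cast
  ring

end euler

end

section

open Polynomial

/-! ### Walks without backtracking -/

theorem ncard_eq_sum_ncard_fiber {X Y : Type*} {s : Set X} (hs : s.Finite) {g : X → Y}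
    {t : Finset Y} (hg : ∀ x ∈ s, g x ∈ t) : s.ncard = ∑ y ∈ t, {x ∈ s | g x = y}.ncard := by
  classical
  rw [Set.ncard_eq_toFinset_card s hs,
    Finset.card_eq_sum_card_fiberwise (f := g) (t := t) fun x hx => hg x (by simpa using hx)]
  refine Finset.sum_congr rfl fun y _ => ?_
  rw [Set.ncard_eq_toFinset_card _ (hs.subset fun x hx => hx.1)]
  congr 1
  ext x
  simp

section walks

variable {V : Type*} (G : SimpleGraph V)

/-- A walk `w₀, …, w_m` without backtracking, as a function on `ℕ` that is constant after `m`. -/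
def IsProperWalk (m : ℕ) (w : ℕ → V) : Prop :=
  (∀ i, i < m → G.Adj (w i) (w (i + 1))) ∧ (∀ i, i + 2 ≤ m → w i ≠ w (i + 2)) ∧
    ∀ i, m ≤ i → w i = w m

/-- The walks of length `m` without backtracking from `x` to `y`. -/
def properWalks (m : ℕ) (x y : V) : Set (ℕ → V) :=
  {w | IsProperWalk G m w ∧ w 0 = x ∧ w m = y}

/-- Put a vertex in front of a walk. -/
def consWalk (x : V) (w : ℕ → V) : ℕ → V
  | 0 => x
  | i + 1 => w i

theorem consWalk_injective (x : V) : Function.Injective (consWalk x) := fun _ _ h =>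
  funext fun i => congrFun h (i + 1)

theorem consWalk_eta (w : ℕ → V) : consWalk (w 0) (fun i => w (i + 1)) = w :=
  funext fun i => by cases i <;> rfl

variable {G}

theorem isProperWalk_consWalk {m : ℕ} {x : V} {w : ℕ → V} :
    IsProperWalk G (m + 1) (consWalk x w)
      ↔ IsProperWalk G m w ∧ G.Adj x (w 0) ∧ x ≠ w 1 := by
  constructor
  · rintro ⟨h1, h2, h3⟩
    refine ⟨⟨fun i hi => h1 (i + 1) (by omega), fun i hi => h2 (i + 1) (by omega),
      fun i hi => h3 (i + 1) (by omega)⟩, h1 0 (by omega), ?_⟩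
    -- For m = 0 the walk is constant, so x ≠ w 1 says no more than the adjacency of x and w 0.
    rcases Nat.eq_zero_or_pos m with rfl | hm
    · have : w 1 = w 0 := h3 2 (by omega)
      rw [this]
      exact (h1 0 (by omega)).ne
    · exact h2 0 (by omega)
  · rintro ⟨⟨h1, h2, h3⟩, h4, h5⟩
    refine ⟨fun i hi => ?_, fun i hi => ?_, fun i hi => ?_⟩
    · cases i with
      | zero => exact h4
      | succ i => exact h1 i (by omega)
    · cases i with
      | zero => exact h5
      | succ i => exact h2 i (by omega)
    · cases i with
      | zero => omega
      | succ i => exact h3 i (by omega)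

variable (G) in
/-- The walks of length `m` without backtracking from a neighbour of `x` to `y`. -/
def neighborWalks (m : ℕ) (x y : V) : Set (ℕ → V) :=
  {w | IsProperWalk G m w ∧ G.Adj x (w 0) ∧ w m = y}

theorem properWalks_succ (m : ℕ) (x y : V) :
    properWalks G (m + 1) x y = consWalk x '' {w ∈ neighborWalks G m x y | w 1 ≠ x} := by
  ext w
  constructor
  · rintro ⟨h1, rfl, h3⟩
    rw [← consWalk_eta w, isProperWalk_consWalk] at h1
    exact ⟨fun i => w (i + 1), ⟨⟨h1.1, h1.2.1, h3⟩, h1.2.2.symm⟩, consWalk_eta w⟩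
  · rintro ⟨w, ⟨⟨h1, h2, h3⟩, h4⟩, rfl⟩
    exact ⟨isProperWalk_consWalk.2 ⟨h1, h2, h4.symm⟩, rfl, h3⟩

theorem properWalks_zero (x y : V) : properWalks G 0 x y = {w | w = (fun _ => x) ∧ x = y} := by
  ext w
  constructor
  · rintro ⟨⟨-, -, h⟩, rfl, rfl⟩
    exact ⟨funext fun i => h i (Nat.zero_le i), rfl⟩
  · rintro ⟨rfl, rfl⟩
    exact ⟨⟨fun i hi => absurd hi (Nat.not_lt_zero i), fun i hi => by omega, fun i hi => rfl⟩,
      rfl, rfl⟩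

open Classical in
theorem ncard_properWalks_zero (x y : V) :
    (properWalks G 0 x y).ncard = if x = y then 1 else 0 := by
  rw [properWalks_zero]
  split_ifs with h <;> simp [h]

variable [G.LocallyFinite]

theorem neighborWalks_eq (m : ℕ) (x y : V) :
    neighborWalks G m x y = ⋃ z ∈ G.neighborFinset x, properWalks G m z y := by
  ext w
  simp only [neighborWalks, properWalks, Set.mem_iUnion, Set.mem_ofPred_eq, exists_prop,
    SimpleGraph.mem_neighborFinset]
  exact ⟨fun h => ⟨w 0, h.2.1, h.1, rfl, h.2.2⟩, fun ⟨z, h1, h2, h3, h4⟩ => ⟨h2, h3 ▸ h1, h4⟩⟩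

theorem finite_properWalks (m : ℕ) (x y : V) : (properWalks G m x y).Finite := by
  induction m generalizing x with
  | zero =>
    rw [properWalks_zero]
    exact (Set.finite_singleton (fun _ : ℕ => x)).subset fun w hw => hw.1
  | succ m ih =>
    rw [properWalks_succ]
    refine Set.Finite.image _ (Set.Finite.subset ?_ (Set.sep_subset _ _))
    rw [neighborWalks_eq]
    exact Set.Finite.biUnion (Finset.finite_toSet _) fun z _ => ih z

theorem finite_neighborWalks (m : ℕ) (x y : V) : (neighborWalks G m x y).Finite := by
  rw [neighborWalks_eq]
  exact Set.Finite.biUnion (Finset.finite_toSet _) fun z _ => finite_properWalks m z y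

theorem ncard_neighborWalks (m : ℕ) (x y : V) :
    (neighborWalks G m x y).ncard = ∑ z ∈ G.neighborFinset x, (properWalks G m z y).ncard := by
  rw [ncard_eq_sum_ncard_fiber (finite_neighborWalks m x y) (g := fun w => w 0)
    (t := G.neighborFinset x) fun w hw => (G.mem_neighborFinset _ _).2 hw.2.1]
  refine Finset.sum_congr rfl fun z hz => congrArg Set.ncard ?_
  ext w
  constructor
  · rintro ⟨⟨h1, -, h2⟩, h3⟩
    exact ⟨h1, h3, h2⟩
  · rintro ⟨h1, rfl, h2⟩
    exact ⟨⟨h1, (G.mem_neighborFinset _ _).1 hz, h2⟩, rfl⟩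

/-- Putting x in front of a walk that starts at a neighbour of x creates backtracking exactly when
the second vertex of that walk is x. -/
theorem ncard_neighborWalks_eq_add (m : ℕ) (x y : V) :
    (neighborWalks G m x y).ncard
      = (properWalks G (m + 1) x y).ncard + {w ∈ neighborWalks G m x y | w 1 = x}.ncard := by
  rw [properWalks_succ, Set.ncard_image_of_injective _ (consWalk_injective x), add_comm]
  exact (Set.ncard_inter_add_ncard_sdiff_eq_ncard (neighborWalks G m x y) {w | w 1 = x}
    (finite_neighborWalks m x y)).symm

theorem ncard_neighborWalks_zero (x y : V) :
    {w ∈ neighborWalks G 0 x y | w 1 = x}.ncard = 0 := by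
  rw [Set.ncard_eq_zero ((finite_neighborWalks 0 x y).subset (Set.sep_subset _ _))]
  refine Set.eq_empty_of_forall_notMem ?_
  rintro w ⟨⟨⟨-, -, h1⟩, h2, -⟩, h3⟩
  rw [← h1 1 (by omega), h3] at h2
  exact h2.ne rfl

/-- Deleting the first vertex z of such a walk leaves a walk w from x, and z may be any neighbour of
x other than w 1. There are q choices in general, but q + 1 when w has length 0, since then w 1 = x
is not a neighbour. This is why the recursion is exceptional at length 2. -/
theorem ncard_neighborWalks_succ {c : ℕ} (m : ℕ) (x y : V)
    (hc : ∀ w ∈ properWalks G m x y, {z | G.Adj x z ∧ z ≠ w 1}.ncard = c) :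
    {w ∈ neighborWalks G (m + 1) x y | w 1 = x}.ncard = c * (properWalks G m x y).ncard := by
  have hfin := (finite_neighborWalks (m + 1) x y).subset
    (Set.sep_subset (neighborWalks G (m + 1) x y) fun w => w 1 = x)
  rw [ncard_eq_sum_ncard_fiber hfin (g := fun w i => w (i + 1))
    (t := (finite_properWalks (G := G) m x y).toFinset) ?_, Finset.sum_eq_card_nsmul (b := c) ?_,
    Set.ncard_eq_toFinset_card _ (finite_properWalks (G := G) m x y), smul_eq_mul, mul_comm]
  · rintro w hw
    rw [Set.Finite.mem_toFinset] at hw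
    rw [← hc w hw, ← Set.ncard_image_of_injective (f := fun z => consWalk z w) _
      fun z z' h => congrFun h 0]
    congr 1
    ext v
    constructor
    · rintro ⟨⟨⟨h1, h2, -⟩, h3⟩, rfl⟩
      refine ⟨v 0, ⟨h2, ?_⟩, consWalk_eta v⟩
      rw [← consWalk_eta v, isProperWalk_consWalk] at h1
      exact h1.2.2
    · rintro ⟨z, ⟨h1, h2⟩, rfl⟩
      exact ⟨⟨⟨isProperWalk_consWalk.2 ⟨hw.1, by rw [hw.2.1]; exact h1.symm, h2⟩, h1, hw.2.2⟩,
        hw.2.1⟩, rfl⟩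
  · rintro w ⟨⟨h1, -, h2⟩, h3⟩
    rw [Set.Finite.mem_toFinset]
    rw [← consWalk_eta w, isProperWalk_consWalk] at h1
    exact ⟨h1.1, h3, h2⟩

variable {q : ℕ}

theorem ncard_adj (hreg : G.IsRegularOfDegree (q + 1)) (x : V) : {z | G.Adj x z}.ncard = q + 1 := by
  rw [← hreg x, ← G.card_neighborSet_eq_degree, ← Nat.card_eq_fintype_card]
  rfl

theorem finite_adj (x : V) : {z | G.Adj x z}.Finite :=
  Set.toFinite (G.neighborSet x)

theorem ncard_properWalks_one (x y : V) :
    (properWalks G 1 x y).ncard = ∑ z ∈ G.neighborFinset x, (properWalks G 0 z y).ncard := by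
  rw [← ncard_neighborWalks, ncard_neighborWalks_eq_add, ncard_neighborWalks_zero, add_zero]

theorem ncard_properWalks_two (hreg : G.IsRegularOfDegree (q + 1)) (x y : V) :
    (properWalks G 2 x y).ncard + (q + 1) * (properWalks G 0 x y).ncard
      = ∑ z ∈ G.neighborFinset x, (properWalks G 1 z y).ncard := by
  rw [← ncard_neighborWalks, ncard_neighborWalks_eq_add, ncard_neighborWalks_succ (c := q + 1)]
  rintro w ⟨⟨-, -, h1⟩, h2, -⟩
  rw [← ncard_adj hreg x]
  congr 1
  ext z
  simp only [Set.mem_ofPred_eq, and_iff_left_iff_imp]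
  rintro h rfl
  rw [h1 1 (by omega), h2] at h
  exact h.ne rfl

theorem ncard_properWalks_add_three (hreg : G.IsRegularOfDegree (q + 1)) (m : ℕ) (x y : V) :
    (properWalks G (m + 3) x y).ncard + q * (properWalks G (m + 1) x y).ncard
      = ∑ z ∈ G.neighborFinset x, (properWalks G (m + 2) z y).ncard := by
  rw [← ncard_neighborWalks, ncard_neighborWalks_eq_add, ncard_neighborWalks_succ (c := q)]
  rintro w ⟨⟨h1, -, -⟩, h2, -⟩
  have h3 : G.Adj x (w 1) := h2 ▸ h1 0 (by omega)
  have h4 := Set.ncard_sdiff_singleton_of_mem (s := {z | G.Adj x z}) (a := w 1) h3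
  rw [ncard_adj hreg x, Nat.add_sub_cancel] at h4
  exact h4

end walks

/-! ### The polynomials counting walks without backtracking -/

/-- `1`, `X`, `X² - (q + 1)` and then `A_{m+1} = X A_m - q A_{m-1}`. -/
def walkPoly (q : ℕ) : ℕ → ℂ[X]
  | 0 => 1
  | 1 => X
  | 2 => X * X - C ((q : ℂ) + 1)
  | m + 3 => X * walkPoly q (m + 2) - C (q : ℂ) * walkPoly q (m + 1)

/-- Both sides satisfy the recursion P_{m+2} = X P_{m+1} - q P_m, so only two initial cases need
checking. The left side is what the tail-cutting recursion for reduced walks produces. -/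
theorem walkPoly_sub (q m : ℕ) :
    walkPoly q (m + 3) - C (q : ℂ) * walkPoly q (m + 1)
      = dickson 1 (q : ℂ) (m + 3) - dickson 1 (q : ℂ) (m + 1) := by
  induction m using Nat.strong_induction_on with
  | _ m ih =>
    match m with
    | 0 =>
      simp only [walkPoly, dickson_add_two, zero_add, dickson_one, dickson_zero]
      simp only [map_add, map_one, Nat.cast_one]
      ring
    | 1 =>
      simp only [walkPoly, dickson_add_two, zero_add, dickson_one, dickson_zero]
      simp only [map_add, map_one, Nat.cast_one]
      ring
    | m + 2 =>
      have h1 := ih (m + 1) (by omega)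
      have h2 := ih m (by omega)
      have w5 : walkPoly q (m + 5)
        = X * walkPoly q (m + 4) - C (q : ℂ) * walkPoly q (m + 3) := rfl
      have w3 : walkPoly q (m + 3)
        = X * walkPoly q (m + 2) - C (q : ℂ) * walkPoly q (m + 1) := rfl
      have d5 := dickson_add_two 1 (q : ℂ) (m + 3)
      have d3 := dickson_add_two 1 (q : ℂ) (m + 1)
      linear_combination w5 - d5 + d3 - C (q : ℂ) * w3 + X * h1 - C (q : ℂ) * h2

/-! ### Traces of the walk polynomials -/

section trace

variable {V : Type*} (G : SimpleGraph V) [G.LocallyFinite] {q : ℕ}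
  (hreg : G.IsRegularOfDegree (q + 1))

open Classical in
/-- The kernel of `A_m(A)` counts the walks of length `m` without backtracking. -/
theorem aeval_walkPoly_apply (m : ℕ) (x y : V) :
    (aeval (adjOp G fun v => (hreg v).le) (walkPoly q m) (lp.single 2 y 1)) x
      = (properWalks G m x y).ncard := by
  induction m using Nat.strong_induction_on generalizing x with
  | _ m ih =>
    match m with
    | 0 =>
      rw [ncard_properWalks_zero]
      simp [walkPoly, Pi.single_apply]
    | 1 =>
      rw [ncard_properWalks_one]
      simp only [walkPoly, aeval_X, adjOp_apply, ncard_properWalks_zero]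
      simp [Pi.single_apply]
    | 2 =>
      have h := ncard_properWalks_two hreg x y
      have h' := congrArg (fun n : ℕ => (n : ℂ)) h
      push_cast at h'
      rw [eq_sub_of_add_eq h', walkPoly, map_sub, map_mul, aeval_C, aeval_X]
      have h1 := fun z => ih 1 (by omega) z
      have h0 := ih 0 (by omega) x
      simp only [walkPoly, aeval_X, map_one] at h1 h0
      rw [← h0]
      simp only [← h1]
      rw [Algebra.algebraMap_eq_smul_one]
      rfl
    | m + 3 =>
      have h := ncard_properWalks_add_three hreg m x y
      have h' := congrArg (fun n : ℕ => (n : ℂ)) h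
      push_cast at h'
      rw [eq_sub_of_add_eq h', walkPoly, map_sub, map_mul, map_mul, aeval_C, aeval_X,
        ← ih (m + 1) (by omega) x]
      simp only [← ih (m + 2) (by omega)]
      rw [Algebra.algebraMap_eq_smul_one, smul_one_mul]
      rfl

variable (Γ : Subgroup (G ≃g G)) [Fintype (MulAction.orbitRel.Quotient Γ V)]

theorem traceCLM_walkPoly (m : ℕ) :
    traceCLM G Γ (aeval (adjOp G fun v => (hreg v).le) (walkPoly q m))
      = ∑ o : MulAction.orbitRel.Quotient Γ V,
        ((properWalks G m (Quotient.out o) (Quotient.out o)).ncard : ℂ) := by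
  rw [traceCLM_apply, traceΓ, finsum_eq_sum_of_fintype]
  exact Finset.sum_congr rfl fun o _ => aeval_walkPoly_apply G hreg m _ _

end trace

end

section

open MulAction

/-! ### Closed walks with a tail -/

section tails

variable {V : Type*} (G : SimpleGraph V)

/-- The closed walks of length `m` at `x` without backtracking and without tail. -/
def reducedWalks (m : ℕ) (x : V) : Set (ℕ → V) :=
  {w ∈ properWalks G m x x | w 1 ≠ w (m - 1)}

/-- The closed walks of length `m` without backtracking and with a tail. -/
def tailWalks (Γ : Subgroup (G ≃g G)) (m : ℕ) : SubMulAction Γ (ℕ → V) where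
  carrier := {w | IsProperWalk G m w ∧ w 0 = w m ∧ w 1 = w (m - 1)}
  smul_mem' γ _ h :=
    ⟨⟨fun i hi => γ.1.map_adj_iff.2 (h.1.1 i hi), fun i hi heq => h.1.2.1 i hi (γ.1.injective heq),
      fun i hi => congrArg γ.1 (h.1.2.2 i hi)⟩, congrArg γ.1 h.2.1, congrArg γ.1 h.2.2⟩

/-- Add a vertex to a walk of length `m`. -/
def snocWalk (m : ℕ) (w : ℕ → V) (x : V) : ℕ → V := fun i => if i ≤ m then w i else x

variable {G} {Γ : Subgroup (G ≃g G)}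

theorem trunc_mem_properWalks {j : ℕ} {w : ℕ → V} (hw : w ∈ tailWalks G Γ (j + 3)) :
    (fun i => w (min i (j + 1) + 1)) ∈ properWalks G (j + 1) (w 1) (w 1) := by
  obtain ⟨⟨h1, h2, -⟩, -, h4⟩ := hw
  refine ⟨⟨fun i hi => ?_, fun i hi => ?_, fun i hi => ?_⟩, by simp, ?_⟩
  · dsimp only
    rw [min_eq_left (by omega), min_eq_left (by omega)]
    exact h1 (i + 1) (by omega)
  · dsimp only
    rw [min_eq_left (by omega), min_eq_left (by omega)]
    exact h2 (i + 1) (by omega)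
  · dsimp only
    rw [min_eq_right hi, min_self]
  · dsimp only
    rw [min_self]
    exact h4.symm

/-- A closed walk with a tail is recovered from the walk w' left after cutting its two end edges and
from its origin x. The conditions x ≠ w' 1 and x ≠ w' j prevent backtracking on leaving and on
returning. -/
theorem tailWalks_fiber {j : ℕ} {y : V} {w' : ℕ → V} (hw' : w' ∈ properWalks G (j + 1) y y) :
    {w | (w ∈ tailWalks G Γ (j + 3) ∧ w 1 = y) ∧ (fun i => w (min i (j + 1) + 1)) = w'}
      = (fun x => consWalk x (snocWalk (j + 1) w' x)) '' {x | G.Adj y x ∧ x ≠ w' 1 ∧ x ≠ w' j} := by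
  ext w
  constructor
  · rintro ⟨⟨⟨⟨h1, h2, h3⟩, h4, h5⟩, rfl⟩, rfl⟩
    refine ⟨w 0, ⟨(h1 0 (by omega)).symm, ?_, ?_⟩, ?_⟩
    · dsimp only
      rw [min_eq_left (by omega)]
      exact h2 0 (by omega)
    · dsimp only
      rw [min_eq_left (by omega), h4]
      exact (h2 (j + 1) (by omega)).symm
    · funext i
      cases i with
      | zero => rfl
      | succ i =>
        simp only [consWalk, snocWalk]
        split_ifs with hi
        · rw [min_eq_left hi]
        · rw [h4, h3 (i + 1) (by omega)]
  · rintro ⟨x, ⟨hx1, hx2, hx3⟩, rfl⟩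
    obtain ⟨⟨h1, h2, h3⟩, h4, h5⟩ := hw'
    have hs : ∀ i, i ≤ j + 1 → snocWalk (j + 1) w' x i = w' i := fun i hi => if_pos hi
    have hs' : ∀ i, j + 1 < i → snocWalk (j + 1) w' x i = x := fun i hi => if_neg (by omega)
    refine ⟨⟨⟨isProperWalk_consWalk.2 ⟨⟨fun i hi => ?_, fun i hi => ?_, fun i hi => ?_⟩, ?_, ?_⟩,
      ?_, ?_⟩, ?_⟩, ?_⟩
    · rw [hs i (by omega)]
      rcases Nat.lt_or_ge i (j + 1) with h | h
      · rw [hs (i + 1) (by omega)]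
        exact h1 i h
      · rw [hs' (i + 1) (by omega), show i = j + 1 by omega, h5]
        exact hx1
    · rw [hs i (by omega)]
      rcases Nat.lt_or_ge i j with h | h
      · rw [hs (i + 2) (by omega)]
        exact h2 i (by omega)
      · rw [hs' (i + 2) (by omega), show i = j by omega]
        exact hx3.symm
    · rw [hs' i (by omega), hs' (j + 2) (by omega)]
    · rw [hs 0 (by omega), h4]
      exact hx1.symm
    · rw [hs 1 (by omega)]
      exact hx2
    · exact (hs' (j + 2) (by omega)).symm
    · show snocWalk (j + 1) w' x 0 = snocWalk (j + 1) w' x (j + 1)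
      rw [hs 0 (by omega), hs (j + 1) le_rfl, h4, h5]
    · show snocWalk (j + 1) w' x 0 = y
      rw [hs 0 (by omega), h4]
    · funext i
      show snocWalk (j + 1) w' x (min i (j + 1)) = w' i
      rw [hs _ (min_le_right _ _)]
      rcases le_total i (j + 1) with h | h
      · rw [min_eq_left h]
      · rw [min_eq_right h, h3 i h]

theorem properWalks_one_self (x : V) : properWalks G 1 x x = ∅ := by
  refine Set.eq_empty_of_forall_notMem ?_
  rintro w ⟨⟨h1, -, -⟩, h2, h3⟩
  have := h1 0 (by omega)
  rw [zero_add, h2, h3] at this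
  exact this.ne rfl

theorem properWalks_two_self (x : V) : properWalks G 2 x x = ∅ := by
  refine Set.eq_empty_of_forall_notMem ?_
  rintro w ⟨⟨-, h1, -⟩, h2, h3⟩
  exact h1 0 (by omega) (h2.trans h3.symm)

theorem reducedWalks_eq_empty {m : ℕ} {x : V} (h : properWalks G m x x = ∅) :
    reducedWalks G m x = ∅ :=
  Set.subset_empty_iff.1 (h ▸ Set.sep_subset _ _)

variable [G.LocallyFinite]

theorem finite_tailWalks_zero (m : ℕ) (y : V) : {w | w ∈ tailWalks G Γ m ∧ w 0 = y}.Finite :=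
  (finite_properWalks m y y).subset fun _ hw => ⟨hw.1.1, hw.2, hw.1.2.1.symm.trans hw.2⟩

theorem finite_tailWalks_one (j : ℕ) (y : V) :
    {w | w ∈ tailWalks G Γ (j + 1) ∧ w 1 = y}.Finite := by
  refine Set.Finite.subset (Set.Finite.biUnion (finite_adj (G := G) y) fun z _ =>
    finite_tailWalks_zero (Γ := Γ) (j + 1) z) ?_
  rintro w ⟨h1, rfl⟩
  exact Set.mem_biUnion (x := w 0) (h1.1.1 0 (by omega)).symm ⟨h1, rfl⟩

variable {q : ℕ}

open Classical in
theorem ncard_adj_ne_ne (hreg : G.IsRegularOfDegree (q + 1)) {y a b : V} (ha : G.Adj y a)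
    (hb : G.Adj y b) :
    {x | G.Adj y x ∧ x ≠ a ∧ x ≠ b}.ncard + (if a ≠ b then 1 else 0) = q := by
  have h1 : {x | G.Adj y x ∧ x ≠ a ∧ x ≠ b} = ({x | G.Adj y x} \ {a}) \ {b} := by
    ext x
    simp [and_assoc]
  have h2 := Set.ncard_sdiff_singleton_of_mem (s := {x | G.Adj y x}) (a := a) ha
  rw [ncard_adj hreg y, Nat.add_sub_cancel] at h2
  rw [h1]
  split_ifs with hab
  · have hmem : b ∈ {x | G.Adj y x} \ {a} := ⟨hb, fun h => hab h.symm⟩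
    rw [Set.ncard_sdiff_singleton_add_one hmem ((finite_adj y).sdiff), h2]
  · rw [not_not] at hab
    subst hab
    rw [Set.sdiff_singleton_eq_self (by simp), h2, add_zero]

/-- A closed walk at y extends by a tail edge in q - 1 ways if it is reduced, since two neighbours
of y are then forbidden, and in q ways if it already has a tail. -/
theorem ncard_tailWalks_one (hreg : G.IsRegularOfDegree (q + 1)) (j : ℕ) (y : V) :
    {w | w ∈ tailWalks G Γ (j + 3) ∧ w 1 = y}.ncard + (reducedWalks G (j + 1) y).ncard
      = q * (properWalks G (j + 1) y y).ncard := by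
  classical
  have hfin := finite_properWalks (G := G) (j + 1) y y
  have hred : (reducedWalks G (j + 1) y).ncard
      = ∑ w ∈ hfin.toFinset, if w 1 ≠ w j then 1 else 0 := by
    rw [← Finset.card_filter, ← Set.ncard_coe_finset]
    congr 1
    ext w
    simp [reducedWalks]
  rw [hred, ncard_eq_sum_ncard_fiber (finite_tailWalks_one (j + 2) y)
    (g := fun w i => w (min i (j + 1) + 1)) (t := hfin.toFinset) ?_, ← Finset.sum_add_distrib,
    Finset.sum_eq_card_nsmul (b := q) ?_, Set.ncard_eq_toFinset_card _ hfin, smul_eq_mul, mul_comm]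
  · intro w hw
    rw [Set.Finite.mem_toFinset] at hw
    have hfib := tailWalks_fiber (Γ := Γ) hw
    have e : {v ∈ {w | w ∈ tailWalks G Γ (j + 3) ∧ w 1 = y} |
        (fun i => v (min i (j + 1) + 1)) = w} = _ := hfib
    rw [e, Set.ncard_image_of_injective _ fun x x' h => congrFun h 0]
    refine ncard_adj_ne_ne hreg ?_ ?_
    · have := hw.1.1 0 (by omega)
      rwa [hw.2.1] at this
    · have := hw.1.1 j (by omega)
      rw [hw.2.2] at this
      exact this.symm
  · rintro w ⟨hw, rfl⟩
    rw [Set.Finite.mem_toFinset]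
    exact trunc_mem_properWalks hw

theorem ncard_tailWalks_zero (m : ℕ) (x : V) :
    {w | w ∈ tailWalks G Γ m ∧ w 0 = x}.ncard + (reducedWalks G m x).ncard
      = (properWalks G m x x).ncard := by
  rw [← Set.ncard_inter_add_ncard_sdiff_eq_ncard (properWalks G m x x) {w | w 1 = w (m - 1)}
    (finite_properWalks m x x)]
  congr 2
  ext w
  constructor
  · rintro ⟨⟨h1, h2, h3⟩, rfl⟩
    exact ⟨⟨h1, rfl, h2.symm⟩, h3⟩
  · rintro ⟨⟨h1, rfl, h2⟩, h3⟩
    exact ⟨⟨h1, h2.symm, h3⟩, rfl⟩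

variable (Γ) [Fintype (orbitRel.Quotient Γ V)]

/-- Both sums count the Γ-orbits of walks with a tail, sorted by w 0 or by w 1. This moves the base
point to the end of the tail's first edge, where the previous count applies. -/
theorem sum_tailWalks (hfree : ∀ γ ∈ Γ, γ ≠ 1 → ∀ v : V, γ v ≠ v) (j : ℕ) :
    ∑ o : orbitRel.Quotient Γ V, {w | w ∈ tailWalks G Γ (j + 1) ∧ w 0 = Quotient.out o}.ncard
      = ∑ o : orbitRel.Quotient Γ V,
        {w | w ∈ tailWalks G Γ (j + 1) ∧ w 1 = Quotient.out o}.ncard := by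
  have e : ∀ (i : ℕ) (y : V), {x : tailWalks G Γ (j + 1) // x.1 i = y}
      ≃ {w | w ∈ tailWalks G Γ (j + 1) ∧ w i = y} := fun i y =>
    Equiv.subtypeSubtypeEquivSubtypeInter (fun w => w ∈ tailWalks G Γ (j + 1)) fun w => w i = y
  have h := fun i hfin => card_orbits_eq_sum (f := fun x : tailWalks G Γ (j + 1) => x.1 i)
    (free_smul G Γ hfree) (fun _ _ => rfl) hfin
  have h0 := h 0 fun y => by
    have := (finite_tailWalks_zero (Γ := Γ) (j + 1) y).to_subtype
    exact Finite.of_equiv _ (e 0 y).symm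
  have h1 := h 1 fun y => by
    have := (finite_tailWalks_one (Γ := Γ) j y).to_subtype
    exact Finite.of_equiv _ (e 1 y).symm
  rw [h0] at h1
  simp only [Nat.card_congr (e _ _), Nat.card_coe_set_eq] at h1
  exact h1

theorem sum_reducedWalks_rec (hreg : G.IsRegularOfDegree (q + 1))
    (hfree : ∀ γ ∈ Γ, γ ≠ 1 → ∀ v : V, γ v ≠ v) (j : ℕ) :
    ∑ o : orbitRel.Quotient Γ V, (properWalks G (j + 3) (Quotient.out o) (Quotient.out o)).ncard
        + ∑ o : orbitRel.Quotient Γ V, (reducedWalks G (j + 1) (Quotient.out o)).ncard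
      = ∑ o : orbitRel.Quotient Γ V, (reducedWalks G (j + 3) (Quotient.out o)).ncard
        + q * ∑ o : orbitRel.Quotient Γ V,
          (properWalks G (j + 1) (Quotient.out o) (Quotient.out o)).ncard := by
  have h1 := sum_tailWalks Γ hfree (j + 2)
  have h2 := Finset.sum_congr rfl fun (o : orbitRel.Quotient Γ V) (_ : o ∈ Finset.univ) =>
    ncard_tailWalks_one (Γ := Γ) hreg j (Quotient.out o)
  have h3 := Finset.sum_congr rfl fun (o : orbitRel.Quotient Γ V) (_ : o ∈ Finset.univ) =>
    ncard_tailWalks_zero (Γ := Γ) (j + 3) (Quotient.out o)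
  rw [Finset.sum_add_distrib] at h2 h3
  rw [← Finset.mul_sum] at h2
  rw [show j + 2 + 1 = j + 3 from rfl] at h1
  omega

/-- The number of orbits of reduced closed walks of length `m`, as a trace. -/
theorem sum_reducedWalks (hreg : G.IsRegularOfDegree (q + 1))
    (hfree : ∀ γ ∈ Γ, γ ≠ 1 → ∀ v : V, γ v ≠ v) (m : ℕ) :
    ((∑ o : orbitRel.Quotient Γ V, (reducedWalks G (m + 1) (Quotient.out o)).ncard : ℕ) : ℂ)
      = powerTrace G hreg Γ (m + 1) + if Even (m + 1) then (q - 1) * (cardVB G Γ : ℂ) else 0 := by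
  have hw : ∀ m, (∑ o : orbitRel.Quotient Γ V,
      ((properWalks G m (Quotient.out o) (Quotient.out o)).ncard : ℂ))
        = traceCLM G Γ (Polynomial.aeval (adjOp G fun v => (hreg v).le) (walkPoly q m)) := fun m =>
    (traceCLM_walkPoly G hreg Γ m).symm
  induction m using Nat.strong_induction_on with
  | _ m ih =>
    match m with
    | 0 =>
      have h0 := hw 1
      simp only [properWalks_one_self, Set.ncard_empty, Nat.cast_zero, Finset.sum_const_zero,
        walkPoly] at h0
      rw [powerTrace, zero_add, Polynomial.dickson_one, ← h0]
      simp [reducedWalks_eq_empty (properWalks_one_self _)]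
    | 1 =>
      have h0 := hw 2
      simp only [properWalks_two_self, Set.ncard_empty, Nat.cast_zero, Finset.sum_const_zero,
        walkPoly, map_sub, Polynomial.aeval_C, Algebra.algebraMap_eq_smul_one, map_smul,
        traceCLM_one, smul_eq_mul] at h0
      simp only [reducedWalks_eq_empty (properWalks_two_self _), Set.ncard_empty,
        Finset.sum_const_zero, Nat.cast_zero]
      -- There are no reduced walks of length 2, while Tr_Γ(A²) = (q+1)|VB| and D_2 = X² - 2q, so
      -- the trace of D_2 is -(q-1)|VB|. The constant 2 is D_0, which `dickson` defines as 3 - 1.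
      rw [if_pos (by decide), powerTrace, show 1 + 1 = 0 + 2 from rfl, Polynomial.dickson_add_two,
        Polynomial.dickson_zero, zero_add, Polynomial.dickson_one,
        show (3 - (1 : ℕ) : Polynomial ℂ) = Polynomial.C 2 by
          rw [Nat.cast_one, show (2 : ℂ) = 3 - 1 by norm_num, map_sub, map_one]
          rfl]
      simp only [map_sub, ← Polynomial.C_mul, Polynomial.aeval_C, Algebra.algebraMap_eq_smul_one,
        map_smul, traceCLM_one, smul_eq_mul]
      linear_combination h0
    | m + 2 =>
      have h1 := congrArg (fun n : ℕ => (n : ℂ)) (sum_reducedWalks_rec Γ hreg hfree m)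
      have h2 := ih m (by omega)
      push_cast at h1 h2 ⊢
      rw [hw, hw, h2] at h1
      have h3 := congrArg (fun P => traceCLM G Γ
        (Polynomial.aeval (adjOp G fun v => (hreg v).le) P)) (walkPoly_sub q m)
      simp only [map_sub, ← Polynomial.smul_eq_C_mul, map_smul, smul_eq_mul] at h3
      have hev : Even (m + 2 + 1) ↔ Even (m + 1) := by
        rw [show m + 2 + 1 = m + 1 + 2 by ring]
        simp [Nat.even_add]
      rw [if_congr hev rfl rfl, powerTrace]
      rw [powerTrace] at h1
      linear_combination h3 - h1

end tails

end

section

open MulAction Function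

/-! ### Reduced closed paths and prime cycles -/

/-- The shift of a sequence. -/
def shift {V : Type*} (w : ℕ → V) : ℕ → V := fun i => w (i + 1)

theorem shift_iterate {V : Type*} (n : ℕ) (w : ℕ → V) (i : ℕ) : (shift^[n] w) i = w (i + n) := by
  induction n generalizing w with
  | zero => rfl
  | succ n ih =>
    rw [iterate_succ_apply, ih]
    exact congrArg w (by omega)

theorem isPeriodicPt_shift_iff {V : Type*} {n : ℕ} {w : ℕ → V} :
    IsPeriodicPt shift n w ↔ ∀ i, w (i + n) = w i := by
  rw [IsPeriodicPt, IsFixedPt, funext_iff]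
  simp only [shift_iterate]

namespace ClosedPath

variable {V : Type*} {G : SimpleGraph V}

theorem vert_mod (C : ClosedPath G) (i : ℕ) : C.vert (i % C.len) = C.vert i := by
  conv_rhs => rw [← Nat.mod_add_div i C.len, mul_comm]
  rw [C.vert_add_mul]

theorem vert_len (C : ClosedPath G) : C.vert C.len = C.vert 0 := by
  rw [← C.periodic 0, zero_add]

/-- A closed path is reduced if and only if it has no backtracking, also across its origin. -/
theorem isReduced_iff (C : ClosedPath G) : C.IsReduced ↔ ∀ i, C.vert i ≠ C.vert (i + 2) := by
  have hpos := C.len_pos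
  have h1 : C.len ≠ 1 := fun h => by
    have h0 := C.adj 0
    rw [← C.periodic 0, h] at h0
    exact h0.ne rfl
  constructor
  · rintro ⟨hp, ht⟩ i heq
    have hp' : ∀ j, j + 2 ≤ C.len → C.vert j ≠ C.vert (j + 2) := fun j hj => by
      have := hp (j + 1) (by omega) (by omega)
      rwa [Nat.add_sub_cancel] at this
    have hlt := Nat.mod_lt i hpos
    have heq' : C.vert (i % C.len) = C.vert (i % C.len + 2) := by
      rw [C.vert_mod, heq, ← C.vert_mod (i + 2), ← C.vert_mod (i % C.len + 2), Nat.mod_add_mod]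
    rcases Nat.lt_or_ge (i % C.len + 1) C.len with h | h
    · exact hp' _ h heq'
    · have hl : i % C.len + 2 = 1 + C.len := by omega
      rw [hl, C.periodic, show i % C.len = C.len - 1 by omega] at heq'
      -- `HasTail` can hold only from length 4 on. A closed path of length 2 backtracks at its
      -- middle vertex, and in length 3 the vertices in question are adjacent.
      rcases Nat.lt_or_ge C.len 4 with h4 | h4
      · have h2 : C.len = 2 ∨ C.len = 3 := by omega
        rcases h2 with h2 | h2
        · have := hp' 0 (by omega)
          rw [zero_add, ← h2, C.vert_len] at this
          exact this rfl
        · rw [h2] at heq'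
          exact (C.adj 1).ne heq'.symm
      · exact ht ⟨1, le_rfl, by omega, fun j hj1 hj2 => by
          rw [show j = 1 by omega]
          exact heq'.symm⟩
  · intro h
    refine ⟨fun i hi _ => ?_, ?_⟩
    · have := h (i - 1)
      rwa [show i - 1 + 2 = i + 1 by omega] at this
    · rintro ⟨k, hk1, hk2, hk⟩
      have h1 := hk 1 le_rfl hk1
      have h2 := h (C.len - 1)
      rw [show C.len - 1 + 2 = 1 + C.len by omega, C.periodic] at h2
      exact h2 h1.symm

theorem isPeriodicPt (C : ClosedPath G) : IsPeriodicPt shift C.len C.vert :=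
  isPeriodicPt_shift_iff.2 C.periodic

/-- The primitive closed path of which `C` is a multiple. -/
def root (C : ClosedPath G) : ClosedPath G where
  len := minimalPeriod shift C.vert
  vert := C.vert
  len_pos := C.isPeriodicPt.minimalPeriod_pos C.len_pos
  periodic := isPeriodicPt_shift_iff.1 (isPeriodicPt_minimalPeriod shift C.vert)
  adj := C.adj

theorem root_len_dvd (C : ClosedPath G) : C.root.len ∣ C.len :=
  C.isPeriodicPt.minimalPeriod_dvd

theorem isPrimitive_root (C : ClosedPath G) : C.root.IsPrimitive := by
  rintro ⟨D, n, hn, hlen, hvert⟩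
  have h1 : IsPeriodicPt shift D.len C.vert := by
    rw [show C.vert = D.vert from funext hvert]
    exact D.isPeriodicPt
  have h2 : C.root.len ≤ D.len := h1.minimalPeriod_le D.len_pos
  have h3 := D.len_pos
  have h4 : 2 * D.len ≤ n * D.len := Nat.mul_le_mul_right _ hn
  omega

theorem IsPrimitive.minimalPeriod_eq {C : ClosedPath G} (hC : C.IsPrimitive) :
    minimalPeriod shift C.vert = C.len := by
  obtain ⟨n, hn⟩ := C.root_len_dvd
  have hpos := C.len_pos
  have : ¬ 2 ≤ n := fun h => hC ⟨C.root, n, h, by rw [hn, mul_comm], fun _ => rfl⟩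
  have h0 : n ≠ 0 := by
    rintro rfl
    omega
  rw [show n = 1 by omega, mul_one] at hn
  exact hn.symm

theorem IsReduced.root {C : ClosedPath G} (hC : C.IsReduced) : C.root.IsReduced :=
  (isReduced_iff C.root).2 fun i => (isReduced_iff C).1 hC i

/-- An automorphism is injective on vertices, so it does not change the periods of a sequence. -/
theorem root_smul (γ : G ≃g G) (C : ClosedPath G) : (γ • C).root = γ • C.root := by
  refine ClosedPath.ext ?_ rfl
  refine minimalPeriod_eq_minimalPeriod_iff.2 fun n => ?_
  rw [isPeriodicPt_shift_iff, isPeriodicPt_shift_iff]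
  exact forall_congr' fun i => γ.injective.eq_iff

/-- The multiple of length `m` of a closed path, with origin shifted by `k`. -/
def multiple (C : ClosedPath G) {m : ℕ} (hm : 0 < m) (h : C.len ∣ m) (k : ℕ) : ClosedPath G where
  len := m
  vert := fun i => C.vert (i + k)
  len_pos := hm
  periodic := fun i => by
    obtain ⟨n, rfl⟩ := h
    rw [add_right_comm, mul_comm, C.vert_add_mul]
  adj := fun i => by
    rw [add_right_comm]
    exact C.adj _

variable (G) in
/-- The reduced closed paths of length `m`. -/
def reducedPaths (Γ : Subgroup (G ≃g G)) (m : ℕ) : SubMulAction Γ (ClosedPath G) where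
  carrier := {C | C.IsReduced ∧ C.len = m}
  smul_mem' γ C h := ⟨(isReduced_iff _).2 fun i heq =>
    (isReduced_iff C).1 h.1 i (γ.1.injective heq), h.2⟩

/-- Reduced closed paths correspond to closed walks without backtracking and without tail. -/
def reducedPathsEquiv (Γ : Subgroup (G ≃g G)) {m : ℕ} (hm : 0 < m) (x : V) :
    {C : reducedPaths G Γ m // C.1.vert 0 = x} ≃ reducedWalks G m x where
  toFun C := ⟨fun i => C.1.1.vert (min i m), by
    obtain ⟨⟨C, hC, rfl⟩, rfl⟩ := C
    have hr := (isReduced_iff C).1 hC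
    refine ⟨⟨⟨fun i hi => ?_, fun i hi => ?_, fun i hi => ?_⟩, ?_, ?_⟩, ?_⟩
    · dsimp only
      rw [min_eq_left (by omega), min_eq_left (by omega)]
      exact C.adj i
    · dsimp only
      rw [min_eq_left (by omega), min_eq_left (by omega)]
      exact hr i
    · dsimp only
      rw [min_eq_right hi, min_self]
    · dsimp only
      rw [min_eq_left (by omega)]
    · dsimp only
      rw [min_self, C.vert_len]
    · dsimp only
      rw [min_eq_left (by omega), min_eq_left (by omega)]
      have := hr (C.len - 1)
      rw [show C.len - 1 + 2 = 1 + C.len by omega, C.periodic] at this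
      exact this.symm⟩
  invFun w := by
    have hw := w.2
    have hlt : ∀ i, i % m < m := fun i => Nat.mod_lt i hm
    have hsucc : ∀ i, i % m + 1 = m ∧ (i + 1) % m = 0 ∨ i % m + 1 < m ∧ (i + 1) % m = i % m + 1 :=
      fun i => by
        rcases Nat.lt_or_ge (i % m + 1) m with h | h
        · exact Or.inr ⟨h, by rw [← Nat.mod_add_mod, Nat.mod_eq_of_lt h]⟩
        · have := hlt i
          have h : i % m + 1 = m := by omega
          exact Or.inl ⟨h, by rw [← Nat.mod_add_mod, h, Nat.mod_self]⟩
    have hadj : ∀ i, G.Adj (w.1 (i % m)) (w.1 ((i + 1) % m)) := fun i => by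
      have := hw.1.1.1 _ (hlt i)
      rcases hsucc i with ⟨h1, h2⟩ | ⟨h1, h2⟩
      · rw [h1, hw.1.2.2] at this
        rw [h2, hw.1.2.1]
        exact this
      · rw [h2]
        exact this
    -- The walk, constant after m, is replaced by its periodic extension. The absence of a tail is
    -- what excludes backtracking across the origin.
    refine ⟨⟨⟨m, fun i => w.1 (i % m), hm, fun i => by rw [Nat.add_mod_right], hadj⟩,
      (isReduced_iff _).2 fun i => ?_, rfl⟩, ?_⟩
    · show w.1 (i % m) ≠ w.1 ((i + 2) % m)
      rcases hsucc i with ⟨h1, h2⟩ | ⟨h1, h2⟩ <;> rcases hsucc (i + 1) with ⟨h3, h4⟩ | ⟨h3, h4⟩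
      · rw [h2] at h3
        have := hadj i
        rw [h2, show i % m = 0 by omega] at this
        exact absurd rfl this.ne
      · rw [show i + 2 = i + 1 + 1 from rfl, h4, h2, show i % m = m - 1 by omega]
        exact hw.2.symm
      · rw [show i + 2 = i + 1 + 1 from rfl, h4, hw.1.2.1]
        have := hw.1.1.2.1 (i % m) (by omega)
        rwa [show i % m + 2 = m by omega, hw.1.2.2] at this
      · rw [show i + 2 = i + 1 + 1 from rfl, h4, h2]
        exact hw.1.1.2.1 _ (by omega)
    · show w.1 (0 % m) = x
      rw [Nat.zero_mod, hw.1.2.1]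
  left_inv := by
    rintro ⟨⟨C, hC, rfl⟩, rfl⟩
    refine Subtype.ext (Subtype.ext (ClosedPath.ext rfl (funext fun i => ?_)))
    show C.vert (min (i % C.len) C.len) = C.vert i
    rw [min_eq_left (Nat.mod_lt i hm).le, C.vert_mod]
  right_inv := by
    rintro ⟨w, hw⟩
    refine Subtype.ext (funext fun i => ?_)
    show w (min i m % m) = w i
    rcases Nat.lt_or_ge i m with h | h
    · rw [min_eq_left h.le, Nat.mod_eq_of_lt h]
    · rw [min_eq_right h, Nat.mod_self, hw.1.1.2.2 i h, hw.1.2.1, hw.1.2.2]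

theorem finite_reducedPaths [G.LocallyFinite] (Γ : Subgroup (G ≃g G)) {m : ℕ} (hm : 0 < m)
    (x : V) : Finite {C : reducedPaths G Γ m // C.1.vert 0 = x} := by
  have : Finite (reducedWalks G m x) :=
    ((finite_properWalks m x x).subset (Set.sep_subset _ _)).to_subtype
  exact Finite.of_equiv _ (reducedPathsEquiv Γ hm x).symm

theorem finite_orbits_reducedPaths [G.LocallyFinite] (Γ : Subgroup (G ≃g G))
    [Finite (orbitRel.Quotient Γ V)] {m : ℕ} (hm : 0 < m) :
    Finite (orbitRel.Quotient Γ (reducedPaths G Γ m)) :=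
  finite_orbits (f := fun C : reducedPaths G Γ m => C.1.vert 0) (fun _ _ => rfl)
    (finite_reducedPaths Γ hm)

theorem card_orbits_reducedPaths [G.LocallyFinite] (Γ : Subgroup (G ≃g G))
    (hfree : ∀ γ ∈ Γ, γ ≠ 1 → ∀ v : V, γ v ≠ v) [Fintype (orbitRel.Quotient Γ V)] {m : ℕ}
    (hm : 0 < m) :
    Nat.card (orbitRel.Quotient Γ (reducedPaths G Γ m))
      = ∑ o : orbitRel.Quotient Γ V, (reducedWalks G m (Quotient.out o)).ncard := by
  rw [card_orbits_eq_sum (f := fun C : reducedPaths G Γ m => C.1.vert 0) (free_smul G Γ hfree)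
    (fun _ _ => rfl) (finite_reducedPaths Γ hm)]
  exact Finset.sum_congr rfl fun o _ => Nat.card_congr (reducedPathsEquiv Γ hm _)

/-- A prime cycle of length `ℓ` is the root of `ℓ` reduced closed paths of length `m` if `ℓ ∣ m`,
and of none otherwise. -/
theorem card_root_fiber (Γ : Subgroup (G ≃g G)) {m : ℕ} (hm : 0 < m) {c : PathCycle G}
    (hc : c.IsPrime) :
    Nat.card {C : reducedPaths G Γ m // (Quotient.mk _ C.1.root : PathCycle G) = c}
      = if c.len ∣ m then c.len else 0 := by
  obtain ⟨D, hD1, hD2, rfl⟩ := hc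
  have hlen : PathCycle.len (Quotient.mk _ D : PathCycle G) = D.len := rfl
  rw [hlen]
  have hD3 := (isReduced_iff D).1 hD1
  -- Shifting the origin preserves the minimal period, so every shifted multiple of D has a rotation
  -- of D as its root; the ℓ shifts k < ℓ are distinct since ℓ is the minimal period.
  have hper : ∀ k, minimalPeriod shift (fun i => D.vert (i + k)) = D.len := fun k => by
    rw [← hD2.minimalPeriod_eq, ← minimalPeriod_apply_iterate
      (mk_mem_periodicPts D.len_pos D.isPeriodicPt) k]
    congr 1
    funext i
    rw [shift_iterate]
  split_ifs with h
  · rw [← Nat.card_fin D.len]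
    refine (Nat.card_eq_of_bijective (fun k : Fin D.len =>
      (⟨⟨D.multiple hm h k, (isReduced_iff _).2 fun i => ?_, rfl⟩, ?_⟩ :
        {C : reducedPaths G Γ m // (Quotient.mk _ C.1.root : PathCycle G) = Quotient.mk _ D}))
      ⟨?_, ?_⟩).symm
    · have := hD3 (i + k)
      rwa [add_right_comm] at this
    · exact Quotient.sound (Setoid.symm ⟨(hper k).symm, k, fun j => rfl⟩)
    · intro k k' hk
      have hv : (fun i => D.vert (i + k)) = fun i => D.vert (i + k') :=
        congrArg (fun C : {C : reducedPaths G Γ m //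
          (Quotient.mk _ C.1.root : PathCycle G) = Quotient.mk _ D} => C.1.1.vert) hk
      refine Fin.ext (iterate_injOn_Iio_minimalPeriod (f := shift) (x := D.vert) ?_ ?_ ?_)
      · rw [hD2.minimalPeriod_eq]
        exact k.2
      · rw [hD2.minimalPeriod_eq]
        exact k'.2
      · funext i
        simp only [shift_iterate]
        exact congrFun hv i
    · rintro ⟨⟨C, hC, hCm⟩, hC'⟩
      obtain ⟨-, k, hk⟩ := Quotient.exact hC'.symm
      refine ⟨⟨k % D.len, Nat.mod_lt k D.len_pos⟩, Subtype.ext (Subtype.ext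
        (ClosedPath.ext hCm.symm (funext fun i => ?_)))⟩
      show D.vert (i + k % D.len) = C.vert i
      rw [← D.vert_mod, Nat.add_mod_mod, D.vert_mod]
      exact (hk i).symm
  · rw [Nat.card_eq_zero]
    refine Or.inl ⟨?_⟩
    rintro ⟨⟨C, hC, rfl⟩, hC'⟩
    obtain ⟨hl, -⟩ := Quotient.exact hC'
    exact h (hl ▸ C.root_len_dvd)

end ClosedPath

end

section

open MulAction ClosedPath

/-! ### The Euler product -/

section primes

variable {V : Type*} (G : SimpleGraph V) (Γ : Subgroup (G ≃g G))

/-- The cycle of the primitive root of a closed path. -/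
def rootCycle {G : SimpleGraph V} (C : ClosedPath G) : PathCycle G := Quotient.mk _ C.root

theorem rootCycle_smul {G : SimpleGraph V} (γ : G ≃g G) (C : ClosedPath G) :
    rootCycle (γ • C) = γ • rootCycle C :=
  congrArg (Quotient.mk _) (root_smul γ C)

/-- The orbit of the prime cycle underlying a reduced closed path. -/
def primeClassMap (m : ℕ) : orbitRel.Quotient Γ (reducedPaths G Γ m) → PrimeClass G Γ :=
  Quotient.map (fun C => ⟨rootCycle C.1, C.1.root, C.2.1.root, C.1.isPrimitive_root, rfl⟩)
    (by
      rintro C D ⟨γ, rfl⟩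
      exact ⟨γ, (rootCycle_smul γ.1 D.1).symm⟩)

theorem primeClassMap_mk_eq_iff {m : ℕ} (C : reducedPaths G Γ m) (P : PrimeClass G Γ) :
    primeClassMap G Γ m (Quotient.mk _ C) = P
      ↔ (Quotient.out P).1 ∈ orbit Γ (rootCycle C.1) := by
  constructor
  · rintro rfl
    exact Quotient.exact (Quotient.out_eq (primeClassMap G Γ m (Quotient.mk _ C)))
  · intro h
    rw [← Quotient.out_eq P]
    exact (Quotient.sound h).symm

variable {G Γ}

/-- The length of a prime cycle in the class `P`. -/
def PrimeClass.len (P : PrimeClass G Γ) : ℕ := (Quotient.out P).1.len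

/-- The order of the stabilizer of a prime cycle in the class `P`. -/
def PrimeClass.cardStab (P : PrimeClass G Γ) : ℕ := Nat.card (stabilizer Γ (Quotient.out P).1)

/-- The number of orbits of reduced closed paths of length `m` over the class `P`. -/
def PrimeClass.count (P : PrimeClass G Γ) (m : ℕ) : ℕ :=
  Nat.card {o // primeClassMap G Γ m o = P}

theorem PrimeClass.len_pos (P : PrimeClass G Γ) : 0 < P.len := by
  obtain ⟨C, -, -, hC⟩ := (Quotient.out P).2
  rw [PrimeClass.len, ← hC]
  exact C.len_pos

/-- The equivariant map sending a reduced path to its root cycle is subject to `card_fiber_eq`: Γ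
acts freely on paths because it does on their origins, and the fibre over a prime cycle has size ℓ
or 0. -/
theorem PrimeClass.count_mul_cardStab (hfree : ∀ γ ∈ Γ, γ ≠ 1 → ∀ v : V, γ v ≠ v)
    (P : PrimeClass G Γ) {m : ℕ} (hm : 0 < m) :
    P.count m * P.cardStab = if P.len ∣ m then P.len else 0 := by
  refine Eq.trans ?_ (card_root_fiber Γ hm (Quotient.out P).2)
  refine (card_fiber_eq (f := fun C : reducedPaths G Γ m => rootCycle C.1)
    (r := fun P : PrimeClass G Γ => (Quotient.out P).1) (fun γ C h => ?_)
    (fun γ C => rootCycle_smul γ.1 C.1) (primeClassMap_mk_eq_iff G Γ) P).symm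
  exact free_smul G Γ hfree γ (C.1.vert 0)
    (congrArg (fun C : reducedPaths G Γ m => C.1.vert 0) h)

/-- `Nat.card` is 0 for an infinite group, so this says that the stabilizer is finite. It follows
from the count at m = ℓ, where the product is ℓ > 0. -/
theorem PrimeClass.cardStab_ne_zero (hfree : ∀ γ ∈ Γ, γ ≠ 1 → ∀ v : V, γ v ≠ v)
    (P : PrimeClass G Γ) : P.cardStab ≠ 0 := fun h => by
  have h1 := P.count_mul_cardStab hfree P.len_pos
  rw [h, mul_zero, if_pos dvd_rfl] at h1
  exact P.len_pos.ne h1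

theorem PrimeClass.count_eq (hfree : ∀ γ ∈ Γ, γ ≠ 1 → ∀ v : V, γ v ≠ v)
    (P : PrimeClass G Γ) {m : ℕ} (hm : 0 < m) :
    (P.count m : ℂ) = if P.len ∣ m then (P.len : ℂ) / P.cardStab else 0 := by
  have h0 : (P.cardStab : ℂ) ≠ 0 := by exact_mod_cast P.cardStab_ne_zero hfree
  have h := congrArg (fun n : ℕ => (n : ℂ)) (P.count_mul_cardStab hfree hm)
  push_cast at h
  split_ifs at h ⊢
  · rw [eq_div_iff h0, h]
  · exact (mul_eq_zero.1 h).resolve_right h0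

/-- The logarithm of an Euler factor. -/
theorem PrimeClass.hasSum_count (hfree : ∀ γ ∈ Γ, γ ≠ 1 → ∀ v : V, γ v ≠ v)
    (P : PrimeClass G Γ) {u : ℂ} (hu : ‖u‖ < 1) :
    HasSum (fun m : ℕ => u ^ (m + 1) / (m + 1 : ℕ) * (P.count (m + 1) : ℂ))
      (Complex.log (1 - u ^ P.len) * (-(1 / (P.cardStab : ℂ)))) := by
  have hl := P.len_pos
  have hl0 : (P.len : ℂ) ≠ 0 := by exact_mod_cast hl.ne'
  have hz : ‖u ^ P.len‖ < 1 := by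
    rw [norm_pow]
    exact pow_lt_one₀ (norm_nonneg u) hu hl.ne'
  have h1 := (Complex.hasSum_taylorSeries_neg_log hz).mul_left (1 / (P.cardStab : ℂ))
  have h2 : HasSum (fun m : ℕ => u ^ m / m * if P.len ∣ m then (P.len : ℂ) / P.cardStab else 0)
      (1 / (P.cardStab : ℂ) * -Complex.log (1 - u ^ P.len)) := by
    -- Only m = kℓ contributes, and there ℓ/(kℓ) = 1/k turns the series into that of -log(1 - u^ℓ).
    -- The zero term at m = 0 is dropped afterwards.
    rw [← Function.Injective.hasSum_iff (mul_right_injective₀ hl.ne')]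
    · refine h1.congr_fun fun k => ?_
      simp only [Function.comp_apply, if_pos (Nat.dvd_mul_right P.len k), Nat.cast_mul, pow_mul]
      rcases eq_or_ne (k : ℂ) 0 with hk | hk
      · simp [hk]
      · field_simp
    · intro m hm
      rw [if_neg, mul_zero]
      rintro ⟨k, rfl⟩
      exact hm ⟨k, rfl⟩
  rw [← hasSum_nat_add_iff' 1] at h2
  have hval : Complex.log (1 - u ^ P.len) * (-(1 / (P.cardStab : ℂ)))
      = 1 / (P.cardStab : ℂ) * -Complex.log (1 - u ^ P.len) - ∑ i ∈ Finset.range 1,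
        u ^ i / (i : ℂ) * if P.len ∣ i then (P.len : ℂ) / P.cardStab else 0 := by
    rw [Finset.sum_range_one, Nat.cast_zero, div_zero, zero_mul]
    ring
  rw [hval]
  exact h2.congr_fun fun m => by rw [P.count_eq hfree (Nat.succ_pos m)]

theorem eulerFactor_eq_exp {u : ℂ} (hu : ‖u‖ < 1) (P : PrimeClass G Γ) :
    eulerFactor G Γ u P
      = Complex.exp (Complex.log (1 - u ^ P.len) * (-(1 / (P.cardStab : ℂ)))) := by
  have hne : 1 - u ^ P.len ≠ 0 := fun h => by
    have h1 : ‖u ^ P.len‖ < 1 := by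
      rw [norm_pow]
      exact pow_lt_one₀ (norm_nonneg u) hu P.len_pos.ne'
    rw [← sub_eq_zero.1 h] at h1
    simp at h1
  rw [← Complex.cpow_def_of_ne_zero hne, eulerFactor, PrimeClass.len, PrimeClass.cardStab]

/-- The finitely many orbits of reduced paths of length m are partitioned by their prime class. -/
theorem PrimeClass.hasSum_count_card [G.LocallyFinite] [Finite (orbitRel.Quotient Γ V)] {m : ℕ}
    (hm : 0 < m) : HasSum (fun P : PrimeClass G Γ => P.count m)
      (Nat.card (orbitRel.Quotient Γ (reducedPaths G Γ m))) := by
  have := finite_orbits_reducedPaths Γ hm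
  let _ := Fintype.ofFinite (orbitRel.Quotient Γ (reducedPaths G Γ m))
  have h1 : HasSum (fun _ : orbitRel.Quotient Γ (reducedPaths G Γ m) => 1)
      (Nat.card (orbitRel.Quotient Γ (reducedPaths G Γ m))) := by
    have := hasSum_fintype fun _ : orbitRel.Quotient Γ (reducedPaths G Γ m) => 1
    simpa [Nat.card_eq_fintype_card] using this
  rw [← (Equiv.sigmaFiberEquiv (primeClassMap G Γ m)).hasSum_iff] at h1
  refine h1.sigma fun P => ?_
  let _ := Fintype.ofFinite {o // primeClassMap G Γ m o = P}
  have := hasSum_fintype fun _ : {o // primeClassMap G Γ m o = P} => 1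
  simpa [PrimeClass.count, Nat.card_eq_fintype_card] using this

variable [G.LocallyFinite] {q : ℕ} [Finite (orbitRel.Quotient Γ V)]

/-- The determinant formula for the sum over all orbits of reduced closed paths. -/
theorem exists_hasSum_card_reducedPaths (hfree : ∀ γ ∈ Γ, γ ≠ 1 → ∀ v : V, γ v ≠ v)
    (hreg : G.IsRegularOfDegree (q + 1)) (hq : 1 ≤ q) {u : ℂ} (hu : ‖u‖ < 1 / q) :
    ∃ L, HasSum (fun m : ℕ => u ^ (m + 1) / (m + 1 : ℕ)
        * (Nat.card (orbitRel.Quotient Γ (reducedPaths G Γ (m + 1))) : ℂ)) L ∧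
      Complex.exp L = zeta G hreg Γ u := by
  let _ := Fintype.ofFinite (orbitRel.Quotient Γ V)
  obtain ⟨S, hS, hdet⟩ := exists_hasSum_powerTrace G hreg Γ hq hu
  have hq0 : (1 : ℝ) ≤ q := by exact_mod_cast hq
  have hu1 : ‖u‖ < 1 := hu.trans_le (by rw [div_le_one (by linarith)]; exact hq0)
  have hu2 : ‖u ^ 2‖ < 1 := by
    rw [norm_pow]
    exact pow_lt_one₀ (norm_nonneg u) hu1 two_ne_zero
  have h1 := (Complex.hasSum_taylorSeries_neg_log hu2).mul_left
    ((q - 1) * (cardVB G Γ : ℂ) / 2)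
  -- The correction at even m = 2k contributes (q-1)|VB|/2 · u^(2k)/k; the sum is χ(B) log(1-u²) by
  -- `eulerChar_eq`.
  have h2 : HasSum (fun m : ℕ => u ^ m / m * if Even m then (q - 1) * (cardVB G Γ : ℂ) else 0)
      ((q - 1) * (cardVB G Γ : ℂ) / 2 * -Complex.log (1 - u ^ 2)) := by
    rw [← Function.Injective.hasSum_iff (mul_right_injective₀ (two_ne_zero (α := ℕ)))]
    · refine h1.congr_fun fun k => ?_
      simp only [Function.comp_apply, if_pos (even_two_mul k), Nat.cast_mul, pow_mul,
        Nat.cast_ofNat]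
      ring
    · intro m hm
      rw [if_neg, mul_zero]
      rintro ⟨k, rfl⟩
      exact hm ⟨k, two_mul k⟩
  have h3 := hS.add h2
  rw [← hasSum_nat_add_iff' 1] at h3
  refine ⟨_, h3.congr_fun fun m => ?_, ?_⟩
  · rw [card_orbits_reducedPaths Γ hfree (Nat.succ_pos m), sum_reducedWalks Γ hreg hfree m]
    ring
  · rw [zeta, hdet, ← Complex.exp_neg, neg_neg, Complex.cpow_def_of_ne_zero
      (one_sub_sq_ne_zero_of_mem_Omega hq (mem_Omega_of_norm_lt hq hu)),
      eulerChar_eq G Γ hreg hfree, ← Complex.exp_add]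
    congr 1
    simp
    ring

/-- The logarithm of the Euler product, by interchanging two sums. -/
theorem hasSum_log_eulerFactor (hfree : ∀ γ ∈ Γ, γ ≠ 1 → ∀ v : V, γ v ≠ v) {u L : ℂ}
    (hu : ‖u‖ < 1) (hL : HasSum (fun m : ℕ => u ^ (m + 1) / (m + 1 : ℕ)
        * (Nat.card (orbitRel.Quotient Γ (reducedPaths G Γ (m + 1))) : ℂ)) L) :
    HasSum (fun P : PrimeClass G Γ =>
      Complex.log (1 - u ^ P.len) * (-(1 / (P.cardStab : ℂ)))) L := by
  obtain ⟨F, hF⟩ : ∃ F : ℕ × PrimeClass G Γ → ℂ, ∀ p, F p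
    = u ^ (p.1 + 1) / (p.1 + 1 : ℕ) * (p.2.count (p.1 + 1) : ℂ) := ⟨_, fun _ => rfl⟩
  have hcard := fun m : ℕ => PrimeClass.hasSum_count_card (G := G) (Γ := Γ) (m := m + 1) (by omega)
  have hrow : ∀ m, HasSum (fun P => F (m, P)) (u ^ (m + 1) / (m + 1 : ℕ)
      * (Nat.card (orbitRel.Quotient Γ (reducedPaths G Γ (m + 1))) : ℂ)) := fun m => by
    have h : HasSum (fun P : PrimeClass G Γ => (P.count (m + 1) : ℂ))
        (Nat.card (orbitRel.Quotient Γ (reducedPaths G Γ (m + 1))) : ℂ) :=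
      (hcard m).map (Nat.castAddMonoidHom ℂ) continuous_of_discreteTopology
    simp only [hF]
    exact h.mul_left _
  have hrow' : ∀ m, HasSum (fun P => ‖F (m, P)‖) ‖u ^ (m + 1) / (m + 1 : ℕ)
      * (Nat.card (orbitRel.Quotient Γ (reducedPaths G Γ (m + 1))) : ℂ)‖ := fun m => by
    have h : HasSum (fun P : PrimeClass G Γ => (P.count (m + 1) : ℝ))
        (Nat.card (orbitRel.Quotient Γ (reducedPaths G Γ (m + 1))) : ℝ) :=
      (hcard m).map (Nat.castAddMonoidHom ℝ) continuous_of_discreteTopology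
    simp only [hF, norm_mul, Complex.norm_natCast]
    exact h.mul_left _
  -- The counts are nonnegative, so the norms in row m add up to the norm of the row total.
  -- Convergence of the series in m is absolute, which makes the double family summable and permits
  -- the interchange.
  have hsum : Summable F := by
    refine Summable.of_norm ?_
    rw [summable_prod_of_nonneg fun p => norm_nonneg _]
    refine ⟨fun m => (hrow' m).summable, ?_⟩
    simp only [fun m => (hrow' m).tsum_eq]
    exact hL.summable.norm
  have htotal : HasSum F L := by
    have := hsum.hasSum
    rwa [(this.prod_fiberwise hrow).unique hL] at this
  have hswap : HasSum (F ∘ Equiv.prodComm (PrimeClass G Γ) ℕ) L :=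
    (Equiv.prodComm (PrimeClass G Γ) ℕ).hasSum_iff.2 htotal
  refine hswap.prod_fiberwise fun P => ?_
  simp only [Function.comp_apply, Equiv.prodComm_apply, Prod.swap_prod_mk, hF]
  exact P.hasSum_count hfree hu

/-- The Euler product converges unconditionally to the determinant expression. -/
theorem hasProd_eulerFactor (hfree : ∀ γ ∈ Γ, γ ≠ 1 → ∀ v : V, γ v ≠ v)
    (hreg : G.IsRegularOfDegree (q + 1)) (hq : 1 ≤ q) {u : ℂ} (hu : ‖u‖ < 1 / q) :
    HasProd (eulerFactor G Γ u) (zeta G hreg Γ u) := by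
  have hq0 : (1 : ℝ) ≤ q := by exact_mod_cast hq
  have hu1 : ‖u‖ < 1 := hu.trans_le (by rw [div_le_one (by linarith)]; exact hq0)
  obtain ⟨L, hL, hexp⟩ := exists_hasSum_card_reducedPaths hfree hreg hq hu
  rw [← hexp, funext (eulerFactor_eq_exp hu1)]
  exact (hasSum_log_eulerFactor hfree hu1 hL).cexp

end primes

end

end IharaPeriodic

end

/-! ### The main theorem -/

theorem mainTheorem6 {V : Type*} [Countable V] (G : SimpleGraph V) [G.LocallyFinite]
    (q : ℕ) (hq : 1 ≤ q) (hreg : G.IsRegularOfDegree (q + 1))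
    (Γ : Subgroup (G ≃g G)) (hfree : ∀ γ ∈ Γ, γ ≠ 1 → ∀ v : V, γ v ≠ v)
    [Finite (MulAction.orbitRel.Quotient Γ V)] :
    (∀ u : ℂ, ‖u‖ < 1 / q →
      HasProd (IharaPeriodic.eulerFactor G Γ u) (IharaPeriodic.zeta G hreg Γ u)) ∧
    (∀ u ∈ IharaPeriodic.Omega q, IharaPeriodic.InDetDomain (IharaPeriodic.deltaOp G hreg u)) ∧
    ∀ u ∈ IharaPeriodic.Omega q, u ≠ 0 →
      1 / (q * u) ∈ IharaPeriodic.Omega q ∧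
      IharaPeriodic.completedΛ G hreg Γ u
        = (-1) ^ IharaPeriodic.cardVB G Γ * IharaPeriodic.completedΛ G hreg Γ (1 / (q * u)) ∧
      IharaPeriodic.completedξ G hreg Γ u = IharaPeriodic.completedξ G hreg Γ (1 / (q * u)) ∧
      IharaPeriodic.completedΞ G hreg Γ u = IharaPeriodic.completedΞ G hreg Γ (1 / (q * u)) :=
  ⟨fun _ hu => IharaPeriodic.hasProd_eulerFactor hfree hreg hq hu,
    fun _ hu => IharaPeriodic.inDetDomain_deltaOp G hreg hq hu, fun _ hu hu0 =>
      ⟨IharaPeriodic.one_div_mem_Omega hq hu hu0,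
        IharaPeriodic.completedΛ_functional_equation G hreg Γ hq hu hu0,
        IharaPeriodic.completedξ_functional_equation G hreg Γ hq hu hu0,
        IharaPeriodic.completedΞ_functional_equation G hreg Γ hq hu hu0⟩⟩
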